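/- All manifolds are finite-dimensional, Hausdorff, $\sigma$-compact, without boundary, and everything is $C^\infty$. **Setting.** Let $\tau_E:E\to Q$ be a vector bundle with a *skew-symmetric algebroid structure*: an $\mathbb R$-bilinear skew-symmetric bracket $[\![\cdot,\cdot]\!]$ on $\Gamma(E)$ and a vector bundle morphism $\rho:E\to TQ$ with $[\![\sigma,f\gamma]\!]=f[\![\sigma,\gamma]\!]+\rho(\sigma)(f)\,\gamma$ for $\sigma,\gamma\in\Gamma(E)$, $f\in C^\infty(Q)$ (no Jacobi identity is required). For $f\in C^\infty(Q)$ and $\beta\in\Gamma(E^*)$ let $d^Ef\in\Gamma(E^*)$, $d^E\beta\in\Gamma(\wedge^2E^*)$ be $$(d^Ef)(\sigma)=\rho(\sigma)(f),\qquad (d^E\beta)(\sigma,\gamma)=\rho(\sigma)(\beta(\gamma))-\rho(\gamma)(\beta(\sigma))-\beta([\![\sigma,\gamma]\!]).$$ Let $\phi\in\Gamma(E^*)$ be a 1-cocycle, $d^E\phi=0$, with $\phi_q\neq0$ for all $q\in Q$. Then $V=\ker\phi\subset E$ is a vector subbundle, the bracket and the anchor of $E$ restrict to a skew-symmetric algebroid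 structure on $V$, and $d^V$ denotes its differential. Let $i_V:V\to E$ be the inclusion and $\mu=i_V^*:E^*\to V^*$ the restriction map. Let $\tau_{E^*}:E^*\to Q$, $\tau_{V^*}:V^*\to Q$ be the projections, and for $\sigma\in\Gamma(E)$ let $\widehat\sigma\in C^\infty(E^*)$ be the fibrewise linear function $\widehat\sigma(\alpha)=\alpha(\sigma(\tau_{E^*}(\alpha)))$. The linear almost Poisson bivector $\Pi_{E^*}$ on $E^*$ is the unique bivector whose bracket $\{F,G\}=\Pi_{E^*}(dF,dG)$ satisfies $$\{\widehat\sigma,\widehat\gamma\}=-\widehat{[\![\sigma,\gamma]\!]},\qquad \{f\circ\tau_{E^*},\widehat\sigma\}=\rho(\sigma)(f)\circ\tau_{E^*},\qquad \{f\circ\tau_{E^*},g\circ\tau_{E^*}\}=0 .$$ Let $h:V^*\to E^*$ be a smooth section of $\mu$ (a smooth map with $\mu\circ h=\mathrm{id}$, not necessarily linear). The function $F_h\in C^\infty(E^*)$ is determined by $$\alpha-h(\mu(\alpha))=F_h(\alpha)\,\phi(q)\qquad(q\in Q,\ \alpha\in E^*_q).$$ The *hamiltonian vector field* $R_h\in\mathfrak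 X(V^*)$ is the vector field characterized by $R_h(G)\circ\mu=\{G\circ\mu,F_h\}$ for all $G\in C^\infty(V^*)$; equivalently $R_h\circ\mu=T\mu\circ\mathcal H_{F_h}$ with $\mathcal H_{F_h}=-i_{dF_h}\Pi_{E^*}$. For $\alpha\in\Gamma(V^*)$ let $R_h^\alpha=T\tau_{V^*}\circ R_h\circ\alpha\in\mathfrak X(Q)$, and let $\zeta_h^\alpha\in\Gamma(E)$ be the section with $$\beta(\zeta_h^\alpha)=dF_h(\beta^\vee)\circ h\circ\alpha\qquad\text{for all }\beta\in\Gamma(E^*),$$ where $\beta^\vee\in\mathfrak X(E^*)$ is the vertical lift, $\beta^\vee(\alpha)=\frac{d}{dt}\big|_{t=0}(\alpha+t\beta(q))$ for $\alpha\in E_q^*$. **Corollary 3.2.** Let $\beta\in\Gamma(E^*)$. The following are equivalent: (i) for every open interval $I\subset\mathbb R$ and every integral curve $c:I\to Q$ of $R_h^{\mu\circ\beta}$, the curve $\mu\circ\beta\circ c:I\to V^*$ is an integral curve of $R_h$; (ii) $\beta$ satisfies the Hamilton–Jacobi equation $$\mu\circ i_{\zeta_h^{\mu\circ\beta}}d^E\beta+d^V(F_h\circ\beta)=0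 .$$ -/

import Mathlib

open Bundle Module Set
open scoped Manifold ContDiff Topology

set_option linter.unusedSectionVars false

noncomputable section

namespace HJ

section KernelBundle

variable {EQ : Type*} [NormedAddCommGroup EQ] [NormedSpace ℝ EQ]
  {Q : Type*} [TopologicalSpace Q] [ChartedSpace EQ Q]
  {F : Type*} [NormedAddCommGroup F] [NormedSpace ℝ F] [FiniteDimensional ℝ F]
  {E : Q → Type*} [TopologicalSpace (TotalSpace F E)] [∀ q, TopologicalSpace (E q)]
  [∀ q, AddCommGroup (E q)] [∀ q, Module ℝ (E q)] [FiberBundle F E] [VectorBundle ℝ F E]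

/-- The fibres of the dual bundle `E*`. -/
abbrev Dual (E : Q → Type*) [∀ q, TopologicalSpace (E q)]
    [∀ q, AddCommGroup (E q)] [∀ q, Module ℝ (E q)] (q : Q) : Type _ := E q →L[ℝ] ℝ

variable (EQ F E) in
/-- Smooth sections `Γ(E)` of a vector bundle `E → Q` with model fibre `F`. -/
abbrev Sec : Type _ := ContMDiffSection 𝓘(ℝ, EQ) F ∞ E

variable (EQ F E) in
/-- A section `φ ∈ Γ(E*)` which vanishes on no fibre of `E`. -/
structure NonvanishingForm where
  /-- the underlying section of `E*` -/
  sec : Sec EQ (F →L[ℝ] ℝ) (Dual E)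
  ne_zero : ∀ q, sec q ≠ 0

/-- The fibres `V_q = {v ∈ E_q | φ(v) = 0}` of the subbundle `V ⊆ E`. -/
def Ker (φ : NonvanishingForm EQ F E) (q : Q) : Type _ :=
  ↥(LinearMap.ker (φ.sec q : E q →ₗ[ℝ] ℝ))

variable (φ : NonvanishingForm EQ F E)

instance (q : Q) : AddCommGroup (Ker φ q) :=
  inferInstanceAs (AddCommGroup ↥(LinearMap.ker (φ.sec q : E q →ₗ[ℝ] ℝ)))
instance (q : Q) : Module ℝ (Ker φ q) :=
  inferInstanceAs (Module ℝ ↥(LinearMap.ker (φ.sec q : E q →ₗ[ℝ] ℝ)))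
instance (q : Q) : TopologicalSpace (Ker φ q) :=
  inferInstanceAs (TopologicalSpace ↥(LinearMap.ker (φ.sec q : E q →ₗ[ℝ] ℝ)))

/-- The canonical inclusion `i_V : V → E`. -/
def incl (q : Q) : Ker φ q →L[ℝ] E q :=
  Submodule.subtypeL (LinearMap.ker (φ.sec q : E q →ₗ[ℝ] ℝ))

theorem incl_injective (q : Q) : Function.Injective (incl φ q) := Subtype.val_injective

theorem apply_incl (q : Q) (v : Ker φ q) : φ.sec q (incl φ q v) = 0 := v.2

/-- A vector of `E_q` on which `φ` vanishes, as a vector of `V_q`. -/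
def Ker.mk {q : Q} (w : E q) (hw : φ.sec q w = 0) : Ker φ q :=
  (⟨w, hw⟩ : ↥(LinearMap.ker (φ.sec q : E q →ₗ[ℝ] ℝ)))

theorem incl_mk {q : Q} (w : E q) (hw : φ.sec q w = 0) : incl φ q (Ker.mk φ w hw) = w := rfl

theorem isInducing_incl (q : Q) : Topology.IsInducing (incl φ q) :=
  Topology.IsInducing.subtypeVal

/-- The map `μ = i_V^* : E* → V*` on fibres. -/
def muFib (q : Q) (α : Dual E q) : Dual (Ker φ) q := α.comp (incl φ q)

/-- The model fibre of `V`: its rank is one less than that of `E`. -/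
abbrev KerModel (F : Type*) [NormedAddCommGroup F] [NormedSpace ℝ F] : Type :=
  EuclideanSpace ℝ (Fin (finrank ℝ F - 1))

/-- The distinguished vector `e_q⁻¹ (A⁻¹ (0, 1))` used to project `E_q` onto `V_q`. -/
def pivot (e : Trivialization F (π F E)) [MemTrivializationAtlas e]
    (A : F ≃L[ℝ] KerModel F × ℝ) (q : Q) : E q := e.symmL ℝ q (A.symm (0, 1))

variable [ContMDiffVectorBundle ∞ F E 𝓘(ℝ, EQ)]

theorem smooth_form (e : Trivialization F (π F E)) [MemTrivializationAtlas e] :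
    ContMDiffOn 𝓘(ℝ, EQ) 𝓘(ℝ, F →L[ℝ] ℝ) ∞
      (fun q => (φ.sec q).comp (e.symmL ℝ q)) e.baseSet := by
  have h1 := (φ.sec.contMDiff).contMDiffOn (s := e.baseSet)
  have : MemTrivializationAtlas (Bundle.Trivial.trivialization Q ℝ) := ⟨rfl⟩
  let e2 := e.continuousLinearMap (RingHom.id ℝ) (Bundle.Trivial.trivialization Q ℝ)
  have h2 := (Trivialization.contMDiffOn_section_iff (IB := 𝓘(ℝ, EQ)) (n := ∞)
    (s := fun q => φ.sec q) e2 e.open_baseSet (by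
      simp [e2, Trivialization.baseSet_continuousLinearMap])).1 h1
  refine h2.congr fun q hq => ?_
  rw [Trivialization.continuousLinearMap_apply]
  ext v
  simp

/-- The open set over which the kernel of `φ` is a graph over `KerModel F` in the given chart. -/
def kerBase (e : Trivialization F (π F E)) [MemTrivializationAtlas e]
    (A : F ≃L[ℝ] KerModel F × ℝ) : Set Q :=
  {q | q ∈ e.baseSet ∧ φ.sec q (pivot e A q) ≠ 0}

theorem isOpen_kerBase (e : Trivialization F (π F E)) [MemTrivializationAtlas e]
    (A : F ≃L[ℝ] KerModel F × ℝ) : IsOpen (kerBase φ e A) := by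
  have h : ContinuousOn (fun q => φ.sec q (pivot e A q)) e.baseSet :=
    (smooth_form φ e).continuousOn.clm_apply (g := fun _ => A.symm (0, 1)) continuousOn_const
  exact h.isOpen_inter_preimage e.open_baseSet isOpen_ne

open Classical in
/-- The vector of `V_q` with coordinates `x`. -/
def kerSymm (e : Trivialization F (π F E)) [MemTrivializationAtlas e]
    (A : F ≃L[ℝ] KerModel F × ℝ) (q : Q) (x : KerModel F) : Ker φ q :=
  if h : φ.sec q (pivot e A q) ≠ 0 then
    Ker.mk φ (e.symmL ℝ q (A.symm (x, 0)) -
      (φ.sec q (e.symmL ℝ q (A.symm (x, 0))) / φ.sec q (pivot e A q)) • pivot e A q) (by simp [h])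
  else 0

theorem incl_kerSymm (e : Trivialization F (π F E)) [MemTrivializationAtlas e]
    (A : F ≃L[ℝ] KerModel F × ℝ) (q : Q) (x : KerModel F) (h : φ.sec q (pivot e A q) ≠ 0) :
    incl φ q (kerSymm φ e A q x) = e.symmL ℝ q (A.symm (x, 0)) -
      (φ.sec q (e.symmL ℝ q (A.symm (x, 0))) / φ.sec q (pivot e A q)) • pivot e A q := by
  rw [kerSymm, dif_pos h, incl_mk]

/-- Local trivialization of `V`: project the coordinates of `v` along the pivot direction. -/
def kerTriv (e : Trivialization F (π F E)) [MemTrivializationAtlas e]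
    (A : F ≃L[ℝ] KerModel F × ℝ) : Pretrivialization (KerModel F) (π (KerModel F) (Ker φ)) where
  toFun p := (p.1, (A (e ⟨p.1, incl φ p.1 p.2⟩).2).1)
  invFun p := ⟨p.1, kerSymm φ e A p.1 p.2⟩
  source := π (KerModel F) (Ker φ) ⁻¹' kerBase φ e A
  target := kerBase φ e A ×ˢ univ
  map_source' := fun p hp => ⟨hp, mem_univ _⟩
  map_target' := fun p hp => hp.1
  left_inv' := by
    rintro ⟨q, v⟩ ⟨hq, hne⟩
    simp only [TotalSpace.mk_inj]
    apply incl_injective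
    rw [incl_kerSymm φ e A q _ hne]
    set y := (e ⟨q, incl φ q v⟩).2 with hy
    have hv : e.symmL ℝ q y = incl φ q v := by
      rw [Trivialization.symmL_apply _ hq, hy, Trivialization.symm_apply_apply_mk _ hq]
    have h1 : A.symm ((A y).1, 0) = y - (A y).2 • A.symm (0, 1) := by
      apply A.injective
      ext <;> simp
    rw [h1, map_sub, map_smul, hv]
    change _ - _ • pivot e A q - _ = _
    simp only [pivot, map_sub, map_smul, apply_incl, smul_eq_mul] at hne ⊢
    rw [zero_sub, neg_div, mul_div_assoc, div_self hne]
    simp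
  right_inv' := by
    rintro ⟨q, x⟩ ⟨⟨hq, hne⟩, -⟩
    simp only [Prod.mk.injEq, true_and]
    rw [incl_kerSymm φ e A q _ hne, pivot]
    have h1 : (e ⟨q, e.symmL ℝ q (A.symm (x, 0)) -
        (φ.sec q (e.symmL ℝ q (A.symm (x, 0))) / φ.sec q (e.symmL ℝ q (A.symm (0, 1)))) •
          e.symmL ℝ q (A.symm (0, 1))⟩).2 = A.symm (x, 0) -
        (φ.sec q (e.symmL ℝ q (A.symm (x, 0))) / φ.sec q (e.symmL ℝ q (A.symm (0, 1)))) •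
          A.symm (0, 1) := by
      rw [← map_smul, ← map_sub, Trivialization.symmL_apply _ hq,
        Trivialization.apply_mk_symm _ hq]
    rw [h1]
    simp
  open_target := (isOpen_kerBase φ e A).prod isOpen_univ
  baseSet := kerBase φ e A
  open_baseSet := isOpen_kerBase φ e A
  source_eq := rfl
  target_eq := rfl
  proj_toFun _ _ := rfl

theorem kerTriv_apply (e : Trivialization F (π F E)) [MemTrivializationAtlas e]
    (A : F ≃L[ℝ] KerModel F × ℝ) (p : TotalSpace (KerModel F) (Ker φ)) :
    kerTriv φ e A p = (p.1, (A (e ⟨p.1, incl φ p.1 p.2⟩).2).1) := rfl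

theorem kerTriv_symm (e : Trivialization F (π F E)) [MemTrivializationAtlas e]
    (A : F ≃L[ℝ] KerModel F × ℝ) {q : Q} (hq : q ∈ kerBase φ e A) (x : KerModel F) :
    (kerTriv φ e A).symm q x = kerSymm φ e A q x := by
  rw [Pretrivialization.symm_apply _ (show q ∈ (kerTriv φ e A).baseSet from hq)]
  rfl

theorem kerTriv_isLinear (e : Trivialization F (π F E)) [MemTrivializationAtlas e]
    (A : F ≃L[ℝ] KerModel F × ℝ) : (kerTriv φ e A).IsLinear ℝ where
  linear q hq := by
    have h := e.linear ℝ (show q ∈ e.baseSet from hq.1)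
    refine ⟨fun v w => ?_, fun c v => ?_⟩
    · simp only [kerTriv_apply, map_add, h.map_add, Prod.fst_add]
    · simp only [kerTriv_apply, map_smul, h.map_smul, Prod.smul_fst]

/-- Coordinate changes of `V`. -/
def kerCoordChange (e e' : Trivialization F (π F E)) [MemTrivializationAtlas e]
    [MemTrivializationAtlas e'] (A A' : F ≃L[ℝ] KerModel F × ℝ) (q : Q) :
    KerModel F →L[ℝ] KerModel F :=
  ((ContinuousLinearMap.fst ℝ (KerModel F) ℝ).comp (A' : F →L[ℝ] KerModel F × ℝ)).comp
    ((e.coordChangeL ℝ e' q : F →L[ℝ] F).comp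
      ((A.symm : KerModel F × ℝ →L[ℝ] F).comp (ContinuousLinearMap.inl ℝ (KerModel F) ℝ) -
        ((φ.sec q).comp (e.symmL ℝ q) (A.symm (0, 1)))⁻¹ •
          (ContinuousLinearMap.smulRightL ℝ (KerModel F) F
            (((φ.sec q).comp (e.symmL ℝ q)).comp
              ((A.symm : KerModel F × ℝ →L[ℝ] F).comp
                (ContinuousLinearMap.inl ℝ (KerModel F) ℝ))) (A.symm (0, 1)))))

theorem kerCoordChange_apply (e e' : Trivialization F (π F E)) [MemTrivializationAtlas e]
    [MemTrivializationAtlas e'] (A A' : F ≃L[ℝ] KerModel F × ℝ) {q : Q}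
    (hq : q ∈ kerBase φ e A ∩ kerBase φ e' A') (x : KerModel F) :
    kerCoordChange φ e e' A A' q x =
      (kerTriv φ e' A' ⟨q, (kerTriv φ e A).symm q x⟩).2 := by
  rw [kerTriv_symm φ e A hq.1, kerTriv_apply]
  simp only
  rw [incl_kerSymm φ e A q x hq.1.2]
  unfold pivot
  rw [← map_smul, ← map_sub, Trivialization.symmL_apply _ hq.1.1,
    ← Trivialization.coordChangeL_apply e e' (R := ℝ) ⟨hq.1.1, hq.2.1⟩]
  simp [kerCoordChange, div_eq_inv_mul, smul_smul]

theorem contMDiffOn_kerCoordChange (e e' : Trivialization F (π F E)) [MemTrivializationAtlas e]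
    [MemTrivializationAtlas e'] (A A' : F ≃L[ℝ] KerModel F × ℝ) :
    ContMDiffOn 𝓘(ℝ, EQ) 𝓘(ℝ, KerModel F →L[ℝ] KerModel F) ∞ (kerCoordChange φ e e' A A')
      (kerBase φ e A ∩ kerBase φ e' A') := by
  have h1 : ContMDiffOn 𝓘(ℝ, EQ) 𝓘(ℝ, F →L[ℝ] ℝ) ∞
      (fun q => (φ.sec q).comp (e.symmL ℝ q)) (kerBase φ e A ∩ kerBase φ e' A') :=
    (smooth_form φ e).mono fun q hq => hq.1.1
  have h2 : ContMDiffOn 𝓘(ℝ, EQ) 𝓘(ℝ, F →L[ℝ] F) ∞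
      (fun q => (e.coordChangeL ℝ e' q : F →L[ℝ] F)) (kerBase φ e A ∩ kerBase φ e' A') :=
    (contMDiffOn_coordChangeL e e').mono fun q hq => ⟨hq.1.1, hq.2.1⟩
  refine ContMDiffOn.clm_comp contMDiffOn_const (h2.clm_comp ?_)
  have h3 := (h1.clm_apply (contMDiffOn_const (c := A.symm (0, 1)))).inv₀ fun q hq => hq.1.2
  have h4 := ContMDiffOn.clm_apply (ContMDiffOn.clm_apply
    (contMDiffOn_const (c := ContinuousLinearMap.smulRightL ℝ (KerModel F) F))
    (h1.clm_comp (contMDiffOn_const (c := (A.symm : KerModel F × ℝ →L[ℝ] F).comp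
      (ContinuousLinearMap.inl ℝ (KerModel F) ℝ))))) (contMDiffOn_const (c := A.symm (0, 1)))
  exact contMDiffOn_const.sub (h3.smul h4)

theorem exists_pivot (e : Trivialization F (π F E)) [MemTrivializationAtlas e] (q : Q)
    (hq : q ∈ e.baseSet) : ∃ A : F ≃L[ℝ] KerModel F × ℝ, q ∈ kerBase φ e A := by
  obtain ⟨w, hw⟩ : ∃ w : E q, φ.sec q w ≠ 0 := by
    by_contra! h
    exact φ.ne_zero q (ContinuousLinearMap.ext h)
  set y := (e ⟨q, w⟩).2 with hy
  have hyw : e.symmL ℝ q y = w := by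
    rw [Trivialization.symmL_apply _ hq, hy, Trivialization.symm_apply_apply_mk _ hq]
  have hy0 : y ≠ 0 := by
    intro h
    rw [h, map_zero] at hyw
    exact hw (by rw [← hyw, map_zero])
  have hpos : 0 < finrank ℝ F := finrank_pos_iff_exists_ne_zero.2 ⟨y, hy0⟩
  have hdim : finrank ℝ F = finrank ℝ (KerModel F × ℝ) := by
    rw [finrank_prod, finrank_euclideanSpace_fin, finrank_self]; omega
  let A₀ : F ≃L[ℝ] KerModel F × ℝ := ContinuousLinearEquiv.ofFinrankEq hdim
  obtain ⟨B, hB⟩ := SeparatingDual.exists_continuousLinearEquiv_apply_eq (R := ℝ)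
    (x := A₀ y) (y := ((0, 1) : KerModel F × ℝ)) (by simpa using hy0) (by simp)
  refine ⟨A₀.trans B, hq, ?_⟩
  have : (A₀.trans B).symm (0, 1) = y := by
    rw [ContinuousLinearEquiv.symm_apply_eq]; exact hB.symm
  rw [pivot, this, hyw]
  exact hw

theorem isInducing_kerTriv (e : Trivialization F (π F E)) [MemTrivializationAtlas e]
    (A : F ≃L[ℝ] KerModel F × ℝ) (q : Q) (hq : q ∈ kerBase φ e A) :
    Topology.IsInducing (kerTriv φ e A ∘ TotalSpace.mk q) := by
  let L : E q ≃L[ℝ] F := e.continuousLinearEquivAt ℝ q hq.1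
  let P : Ker φ q → KerModel F := fun v => (A (L (incl φ q v))).1
  have hP : Continuous P :=
    continuous_fst.comp (A.continuous.comp (L.continuous.comp (incl φ q).continuous))
  let R : KerModel F → E q := fun x => e.symmL ℝ q (A.symm (x, 0)) -
      (φ.sec q (e.symmL ℝ q (A.symm (x, 0))) / φ.sec q (pivot e A q)) • pivot e A q
  let R' : KerModel F →ₗ[ℝ] F :=
    { toFun := fun x => A.symm (x, 0) -
        (φ.sec q (e.symmL ℝ q (A.symm (x, 0))) / φ.sec q (pivot e A q)) • A.symm (0, 1)
      map_add' := fun x y => by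
        have : ((x + y, 0) : KerModel F × ℝ) = (x, 0) + (y, 0) := by simp
        simp only [this, map_add, add_div, add_smul]; abel
      map_smul' := fun c x => by
        have : ((c • x, 0) : KerModel F × ℝ) = c • (x, 0) := by simp
        simp only [this, map_smul, smul_sub, smul_smul, smul_eq_mul, mul_div_assoc,
          RingHom.id_apply] }
  have hR' : Continuous R' := LinearMap.continuous_of_finiteDimensional R'
  have hcomp : ∀ v : Ker φ q, R' (P v) = L (incl φ q v) := by
    intro v
    have h := (kerTriv φ e A).left_inv (x := ⟨q, v⟩) hq
    have h' : kerSymm φ e A q (P v) = v := by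
      have := h
      simp only [kerTriv] at this
      exact TotalSpace.mk_injective q this
    have h2 := incl_kerSymm φ e A q (P v) hq.2
    rw [h'] at h2
    rw [h2, pivot, ← map_smul, ← map_sub]
    change _ = (e ⟨q, e.symmL ℝ q _⟩).2
    rw [Trivialization.symmL_apply _ hq.1, Trivialization.apply_mk_symm _ hq.1]
    rfl
  have hind : Topology.IsInducing (L ∘ incl φ q) :=
    L.toHomeomorph.isInducing.comp (isInducing_incl φ q)
  have h3 : Topology.IsInducing P := by
    refine Topology.IsInducing.of_comp hP hR' ?_
    convert hind using 1
    exact funext hcomp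
  exact Topology.isInducing_const_prod.2 h3

/-- The vector bundle structure of `V`. -/
def kerPrebundle : VectorPrebundle ℝ (KerModel F) (Ker φ) where
  pretrivializationAtlas :=
    {t | ∃ (e : Trivialization F (π F E)) (_ : MemTrivializationAtlas e)
      (A : F ≃L[ℝ] KerModel F × ℝ), t = kerTriv φ e A}
  pretrivialization_linear' := by
    rintro _ ⟨e, he, A, rfl⟩
    exact kerTriv_isLinear φ e A
  pretrivializationAt q := kerTriv φ (trivializationAt F E q)
    (exists_pivot φ (trivializationAt F E q) q (mem_baseSet_trivializationAt F E q)).choose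
  mem_base_pretrivializationAt q :=
    (exists_pivot φ (trivializationAt F E q) q (mem_baseSet_trivializationAt F E q)).choose_spec
  pretrivialization_mem_atlas q := ⟨_, inferInstance, _, rfl⟩
  exists_coordChange := by
    rintro _ ⟨e, he, A, rfl⟩ _ ⟨e', he', A', rfl⟩
    exact ⟨kerCoordChange φ e e' A A', (contMDiffOn_kerCoordChange φ e e' A A').continuousOn,
      fun q hq x => kerCoordChange_apply φ e e' A A' hq x⟩
  totalSpaceMk_isInducing q := isInducing_kerTriv φ _ _ q
    (exists_pivot φ (trivializationAt F E q) q (mem_baseSet_trivializationAt F E q)).choose_spec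

instance : TopologicalSpace (TotalSpace (KerModel F) (Ker φ)) :=
  (kerPrebundle φ).totalSpaceTopology

instance : FiberBundle (KerModel F) (Ker φ) := (kerPrebundle φ).toFiberBundle

instance : VectorBundle ℝ (KerModel F) (Ker φ) := (kerPrebundle φ).toVectorBundle

instance : (kerPrebundle φ).IsContMDiff 𝓘(ℝ, EQ) ∞ where
  exists_contMDiffCoordChange := by
    rintro _ ⟨e, he, A, rfl⟩ _ ⟨e', he', A', rfl⟩
    exact ⟨kerCoordChange φ e e' A A', contMDiffOn_kerCoordChange φ e e' A A',
      fun q hq x => kerCoordChange_apply φ e e' A A' hq x⟩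

instance : ContMDiffVectorBundle ∞ (KerModel F) (Ker φ) 𝓘(ℝ, EQ) :=
  (kerPrebundle φ).contMDiffVectorBundle 𝓘(ℝ, EQ)

end KernelBundle
section Algebroid

variable {EQ : Type*} [NormedAddCommGroup EQ] [NormedSpace ℝ EQ] [FiniteDimensional ℝ EQ]
  {Q : Type*} [TopologicalSpace Q] [ChartedSpace EQ Q] [IsManifold 𝓘(ℝ, EQ) ∞ Q] [T2Space Q]
  {F : Type*} [NormedAddCommGroup F] [NormedSpace ℝ F] [FiniteDimensional ℝ F]
  {E : Q → Type*} [TopologicalSpace (TotalSpace F E)] [∀ q, TopologicalSpace (E q)]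
  [∀ q, AddCommGroup (E q)] [∀ q, Module ℝ (E q)] [FiberBundle F E] [VectorBundle ℝ F E]
  [ContMDiffVectorBundle ∞ F E 𝓘(ℝ, EQ)]

/-- The differential `df` at `x` of a real function on a manifold, as a covector. -/
def dif {EM HM M : Type*} [NormedAddCommGroup EM] [NormedSpace ℝ EM] [TopologicalSpace HM]
    (I : ModelWithCorners ℝ EM HM) [TopologicalSpace M] [ChartedSpace HM M] (f : M → ℝ) (x : M) :
    TangentSpace I x →L[ℝ] ℝ := mfderiv I 𝓘(ℝ, ℝ) f x

section dif

variable {EM HM M : Type*} [NormedAddCommGroup EM] [NormedSpace ℝ EM] [TopologicalSpace HM]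
    {I : ModelWithCorners ℝ EM HM} [TopologicalSpace M] [ChartedSpace HM M] {f g : M → ℝ} {x : M}

theorem dif_add (hf : MDifferentiableAt I 𝓘(ℝ, ℝ) f x) (hg : MDifferentiableAt I 𝓘(ℝ, ℝ) g x) :
    dif I (fun y => f y + g y) x = dif I f x + dif I g x :=
  (hf.hasMFDerivAt.add hg.hasMFDerivAt).mfderiv

theorem dif_mul (hf : MDifferentiableAt I 𝓘(ℝ, ℝ) f x) (hg : MDifferentiableAt I 𝓘(ℝ, ℝ) g x) :
    dif I (fun y => f y * g y) x = f x • dif I g x + g x • dif I f x :=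
  (hf.hasMFDerivAt.mul hg.hasMFDerivAt).mfderiv

theorem dif_const_mul (c : ℝ) (hf : MDifferentiableAt I 𝓘(ℝ, ℝ) f x) :
    dif I (fun y => c * f y) x = c • dif I f x :=
  (hf.hasMFDerivAt.const_smul c).mfderiv

end dif

/-- Linear functionals on a fibre `E_q` are continuous. -/
def toDual (q : Q) : (E q →ₗ[ℝ] ℝ) ≃ₗ[ℝ] Dual E q :=
  haveI : T2Space (E q) := FiberBundle.t2Space F E q
  haveI : FiniteDimensional ℝ (E q) := VectorBundle.finiteDimensional ℝ F E q
  haveI : IsTopologicalAddGroup (E q) :=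
    (VectorBundle.continuousLinearEquivAt ℝ F E q).toContinuousAddEquiv.isTopologicalAddGroup
  haveI : ContinuousSMul ℝ (E q) :=
    (VectorBundle.continuousLinearEquivAt ℝ F E q).continuousSMul
  LinearMap.toContinuousLinearMap

theorem toDual_apply (q : Q) (l : E q →ₗ[ℝ] ℝ) (u : E q) : toDual (F := F) q l u = l u := rfl

/-- Smooth functions `C^∞(Q)`. -/
abbrev SmoothFun (EQ Q : Type*) [NormedAddCommGroup EQ] [NormedSpace ℝ EQ]
    [TopologicalSpace Q] [ChartedSpace EQ Q] : Type _ := C^∞⟮𝓘(ℝ, EQ), Q; 𝓘(ℝ, ℝ), ℝ⟯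

/-- The product `f σ` of a smooth function and a section. -/
def smulSec (f : SmoothFun EQ Q) (σ : Sec EQ F E) : Sec EQ F E :=
  ⟨fun q => f q • σ q, f.contMDiff.smul_section σ.contMDiff⟩

theorem exists_bump (q : Q) {U : Set Q} (hU : U ∈ 𝓝 q) :
    ∃ ψ : SmoothFun EQ Q, ψ q = 1 ∧ tsupport ψ ⊆ U := by
  obtain ⟨f, -, hf⟩ := (SmoothBumpFunction.nhds_basis_tsupport (I := 𝓘(ℝ, EQ)) q).mem_iff.1 hU
  exact ⟨⟨f, f.contMDiff⟩, f.eq_one, hf⟩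

theorem exists_sec (q : Q) (u : E q) : ∃ σ : Sec EQ F E, σ q = u := by
  obtain ⟨s, hs, hsm⟩ := FiberBundle.exists_contMDiffOn_extend (k := ∞) 𝓘(ℝ, EQ) F u
  obtain ⟨U, hUs, hU, hq⟩ := mem_nhds_iff.1 hs
  obtain ⟨ψ, h1, h2⟩ := exists_bump (EQ := EQ) q (hU.mem_nhds hq)
  refine ⟨⟨(ψ : Q → ℝ) • FiberBundle.extend F u,
    ContMDiffOn.smul_section_of_tsupport ψ.contMDiff.contMDiffOn hU h2 (hsm.mono hUs)⟩, ?_⟩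
  simp [h1]

/-- Evaluation of sections at a point. -/
def evalAt (q : Q) : Sec EQ F E →ₗ[ℝ] E q where
  toFun σ := σ q
  map_add' _ _ := rfl
  map_smul' _ _ := rfl

/-- A `C^∞(Q)`-linear functional on sections only depends on the value of the section. -/
theorem tensorial_zero (q : Q) (T : Sec EQ F E →ₗ[ℝ] ℝ)
    (hT : ∀ f σ, T (smulSec f σ) = f q * T σ) (σ : Sec EQ F E) (hσ : σ q = 0) : T σ = 0 := by
  set t := trivializationAt F E q with ht
  have hq : q ∈ t.baseSet := mem_baseSet_trivializationAt F E q
  let b := finBasis ℝ F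
  obtain ⟨ψ, h1, h2⟩ := exists_bump (EQ := EQ) q (t.open_baseSet.mem_nhds hq)
  have hs : ∀ i, ContMDiffOn 𝓘(ℝ, EQ) (𝓘(ℝ, EQ).prod 𝓘(ℝ, F)) ∞
      (fun x => TotalSpace.mk' F x (t.symm x (b i))) t.baseSet := fun i => by
    rw [t.contMDiffOn_section_baseSet_iff]
    exact (contMDiffOn_const (c := b i)).congr fun x hx => by
      rw [t.apply_mk_symm hx]
  have hc : ∀ i, ContMDiffOn 𝓘(ℝ, EQ) 𝓘(ℝ, ℝ) ∞
      (fun x => b.repr ((t ⟨x, σ x⟩).2) i) t.baseSet := fun i => by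
    have := (t.contMDiffOn_section_baseSet_iff (n := ∞) (IB := 𝓘(ℝ, EQ)) (s := fun x => σ x)).1
      σ.contMDiff.contMDiffOn
    exact ContMDiffOn.clm_apply (contMDiffOn_const (c := LinearMap.toContinuousLinearMap (b.coord i)))
      this
  let S : Fin (finrank ℝ F) → Sec EQ F E := fun i =>
    ⟨(ψ : Q → ℝ) • fun x => t.symm x (b i),
      ContMDiffOn.smul_section_of_tsupport ψ.contMDiff.contMDiffOn t.open_baseSet h2 (hs i)⟩
  have hC : ∀ i, ContMDiff 𝓘(ℝ, EQ) 𝓘(ℝ, ℝ) ∞ (fun x => ψ x * b.repr ((t ⟨x, σ x⟩).2) i) := by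
    intro i
    refine contMDiff_of_tsupport fun x hx => ?_
    have hx' : x ∈ t.baseSet := h2 (tsupport_mul_subset_left hx)
    exact (ψ.contMDiff.contMDiffAt).mul ((hc i).contMDiffAt (t.open_baseSet.mem_nhds hx'))
  let C : Fin (finrank ℝ F) → SmoothFun EQ Q := fun i => ⟨_, hC i⟩
  have key : smulSec ψ (smulSec ψ σ) = ∑ i, smulSec (C i) (S i) := by
    ext x
    change ψ x • ψ x • σ x = _
    change _ = evalAt x (∑ i, smulSec (C i) (S i))
    rw [map_sum]
    change _ = ∑ i, (ψ x * b.repr ((t ⟨x, σ x⟩).2) i) • (ψ x • t.symm x (b i))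
    by_cases hx : x ∈ t.baseSet
    · simp only [← t.symmL_apply (R := ℝ) hx]
      have h3 : ∀ i, (ψ x * b.repr ((t ⟨x, σ x⟩).2) i) • (ψ x • t.symmL ℝ x (b i)) =
          ψ x • ψ x • (t.symmL ℝ x (b.repr ((t ⟨x, σ x⟩).2) i • b i)) := fun i => by
        rw [map_smul, smul_smul, smul_smul, smul_smul]; congr 1; ring
      simp only [h3]
      rw [← Finset.smul_sum, ← Finset.smul_sum, ← map_sum, b.sum_repr, t.symmL_apply hx,
        t.symm_apply_apply_mk hx]
    · have h0 : ψ x = 0 := image_eq_zero_of_notMem_tsupport fun h => hx (h2 h)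
      simp [h0]
  have := congrArg T key
  rw [map_sum, hT, hT, h1] at this
  rw [one_mul, one_mul] at this
  rw [this]
  refine Finset.sum_eq_zero fun i _ => ?_
  rw [hT]
  have h0 : (t ⟨q, σ q⟩).2 = 0 := by
    rw [hσ]
    exact (t.linear ℝ hq).map_zero
  change (ψ q * b.repr ((t ⟨q, σ q⟩).2) i) * _ = 0
  rw [h0]; simp

variable (EQ Q F E) in
/-- A skew-symmetric algebroid structure on the vector bundle `E → Q`: an `ℝ`-bilinear
skew-symmetric bracket on `Γ(E)` and a vector bundle map `ρ : E → TQ` with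
`⟦σ, f γ⟧ = f ⟦σ, γ⟧ + ρ(σ)(f) γ`. -/
structure SkewAlgebroid where
  /-- the bracket of sections -/
  bracket : Sec EQ F E →ₗ[ℝ] Sec EQ F E →ₗ[ℝ] Sec EQ F E
  /-- the anchor map, fibre by fibre -/
  anchor : ∀ q, E q →L[ℝ] TangentSpace 𝓘(ℝ, EQ) q
  contMDiff_anchor : ContMDiff (𝓘(ℝ, EQ).prod 𝓘(ℝ, F)) 𝓘(ℝ, EQ).tangent ∞
    (fun v : TotalSpace F E => (⟨v.1, anchor v.1 v.2⟩ : TangentBundle 𝓘(ℝ, EQ) Q))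
  skew : ∀ σ γ, bracket σ γ = -bracket γ σ
  leibniz : ∀ (σ γ : Sec EQ F E) (f : SmoothFun EQ Q) (q : Q),
    bracket σ (smulSec f γ) q =
      f q • bracket σ γ q + dif 𝓘(ℝ, EQ) f q (anchor q (σ q)) • γ q

namespace SkewAlgebroid

variable (A : SkewAlgebroid EQ Q F E)

/-- The differential `(d^E f)_q = (df)_q ∘ ρ_q` of a function `f` on `Q`, i.e.
`(d^E f)(σ) = ρ(σ)(f)`. -/
def dFun (f : Q → ℝ) (q : Q) : Dual E q :=
  (dif 𝓘(ℝ, EQ) f q).comp (A.anchor q)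

/-- The function `β(σ)` on `Q`. -/
def pair (β : Sec EQ (F →L[ℝ] ℝ) (Dual E)) (σ : Sec EQ F E) (q : Q) : ℝ := β q (σ q)

theorem contMDiff_pair (β : Sec EQ (F →L[ℝ] ℝ) (Dual E)) (σ : Sec EQ F E) :
    ContMDiff 𝓘(ℝ, EQ) 𝓘(ℝ, ℝ) ∞ (pair β σ) := by
  have h := ContMDiff.clm_bundle_apply (F₂ := ℝ) (E₂ := fun _ : Q => ℝ) β.contMDiff σ.contMDiff
  intro q
  exact ((contMDiffAt_section q).1 (h q))

theorem mdiff_pair (β : Sec EQ (F →L[ℝ] ℝ) (Dual E)) (σ : Sec EQ F E) (q : Q) :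
    MDifferentiableAt 𝓘(ℝ, EQ) 𝓘(ℝ, ℝ) (pair β σ) q :=
  (contMDiff_pair β σ q).mdifferentiableAt (by simp)

/-- `ρ(σ)(β(γ)) - ρ(γ)(β(σ)) - β(⟦σ, γ⟧)` at the point `q`. -/
def cartan (β : Sec EQ (F →L[ℝ] ℝ) (Dual E)) (q : Q) (σ γ : Sec EQ F E) : ℝ :=
  A.dFun (pair β γ) q (σ q) - A.dFun (pair β σ) q (γ q) - pair β (A.bracket σ γ) q

theorem cartan_skew (β : Sec EQ (F →L[ℝ] ℝ) (Dual E)) (q : Q) (σ γ : Sec EQ F E) :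
    A.cartan β q σ γ = -A.cartan β q γ σ := by
  unfold cartan
  have : pair β (A.bracket σ γ) q = -pair β (A.bracket γ σ) q := by
    rw [A.skew σ γ]
    exact map_neg (β q) _
  rw [this]; ring

theorem cartan_add (β : Sec EQ (F →L[ℝ] ℝ) (Dual E)) (q : Q) (σ σ' γ : Sec EQ F E) :
    A.cartan β q (σ + σ') γ = A.cartan β q σ γ + A.cartan β q σ' γ := by
  have h1 : dif 𝓘(ℝ, EQ) (pair β (σ + σ')) q =
      dif 𝓘(ℝ, EQ) (pair β σ) q + dif 𝓘(ℝ, EQ) (pair β σ') q := by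
    rw [← dif_add (mdiff_pair β σ q) (mdiff_pair β σ' q)]
    congr 1
    ext x
    exact map_add (β x) _ _
  have h2 : pair β (A.bracket (σ + σ') γ) q =
      pair β (A.bracket σ γ) q + pair β (A.bracket σ' γ) q := by
    rw [map_add, LinearMap.add_apply]
    exact map_add (β q) _ _
  have h3 : (σ + σ') q = σ q + σ' q := rfl
  simp only [cartan, dFun, ContinuousLinearMap.comp_apply, h1, h2, h3]
  simp only [map_add, _root_.add_apply]
  ring

theorem cartan_smul (β : Sec EQ (F →L[ℝ] ℝ) (Dual E)) (q : Q) (c : ℝ) (σ γ : Sec EQ F E) :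
    A.cartan β q (c • σ) γ = c * A.cartan β q σ γ := by
  have h1 : dif 𝓘(ℝ, EQ) (pair β (c • σ)) q = c • dif 𝓘(ℝ, EQ) (pair β σ) q := by
    rw [← dif_const_mul c (mdiff_pair β σ q)]
    congr 1
    ext x
    exact map_smul (β x) _ _
  have h2 : pair β (A.bracket (c • σ) γ) q = c * pair β (A.bracket σ γ) q := by
    rw [map_smul, LinearMap.smul_apply]
    exact map_smul (β q) _ _
  have h3 : (c • σ) q = c • σ q := rfl
  simp only [cartan, dFun, ContinuousLinearMap.comp_apply, h1, h2, h3]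
  simp only [map_smul, _root_.smul_apply, smul_eq_mul]
  ring

theorem cartan_smulSec (β : Sec EQ (F →L[ℝ] ℝ) (Dual E)) (q : Q) (f : SmoothFun EQ Q)
    (σ γ : Sec EQ F E) : A.cartan β q (smulSec f σ) γ = f q * A.cartan β q σ γ := by
  have h1 : dif 𝓘(ℝ, EQ) (pair β (smulSec f σ)) q =
      f q • dif 𝓘(ℝ, EQ) (pair β σ) q + pair β σ q • dif 𝓘(ℝ, EQ) f q := by
    rw [← dif_mul (f.contMDiff.mdifferentiableAt (by simp)) (mdiff_pair β σ q)]
    congr 1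
    ext x
    exact map_smul (β x) _ _
  have h2 : pair β (A.bracket (smulSec f σ) γ) q =
      f q * pair β (A.bracket σ γ) q - A.dFun f q (γ q) * pair β σ q := by
    rw [A.skew, A.skew σ γ]
    change β q (-(A.bracket γ (smulSec f σ) q)) = f q * β q (-(A.bracket γ σ q)) - _
    rw [A.leibniz, map_neg, map_neg, map_add, map_smul, map_smul]
    simp only [dFun, pair, ContinuousLinearMap.comp_apply, smul_eq_mul]
    ring
  have h3 : (smulSec f σ) q = f q • σ q := rfl
  simp only [cartan, h2, h3, map_smul, smul_eq_mul]
  simp only [dFun, ContinuousLinearMap.comp_apply, h1, _root_.add_apply, _root_.smul_apply,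
    smul_eq_mul]
  ring

theorem exists_dForm (β : Sec EQ (F →L[ℝ] ℝ) (Dual E)) (q : Q) :
    ∃ B : E q →ₗ[ℝ] Dual E q, ∀ σ γ : Sec EQ F E, B (σ q) (γ q) = A.cartan β q σ γ := by
  let D : Sec EQ F E →ₗ[ℝ] Sec EQ F E →ₗ[ℝ] ℝ := LinearMap.mk₂ ℝ (A.cartan β q)
    (A.cartan_add β q) (A.cartan_smul β q)
    (fun σ γ γ' => by
      rw [cartan_skew, cartan_add, neg_add, ← cartan_skew, ← cartan_skew])
    (fun c σ γ => by
      rw [cartan_skew, cartan_smul, ← mul_neg, ← cartan_skew]; rfl)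
  obtain ⟨s, hs⟩ := LinearMap.exists_rightInverse_of_surjective (evalAt (EQ := EQ) (F := F) (E := E) q)
    (LinearMap.range_eq_top.2 fun u => exists_sec q u)
  have hs' : ∀ u, (s u) q = u := fun u => LinearMap.congr_fun hs u
  have hD1 : ∀ σ σ' γ : Sec EQ F E, σ q = σ' q → D σ γ = D σ' γ := by
    intro σ σ' γ h
    have := tensorial_zero q (D.flip γ) (fun f τ => A.cartan_smulSec β q f τ γ) (σ - σ')
      (sub_eq_zero.2 h)
    rw [map_sub, sub_eq_zero] at this
    exact this
  have hD2 : ∀ σ γ : Sec EQ F E, D σ γ = -D γ σ := A.cartan_skew β q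
  refine ⟨(toDual (F := F) q).toLinearMap ∘ₗ D.compl₁₂ s s, fun σ γ => ?_⟩
  change D (s (σ q)) (s (γ q)) = D σ γ
  rw [hD1 _ σ _ (hs' _), hD2, hD1 _ γ _ (hs' _), ← hD2]

/-- The differential `d^E β ∈ Γ(Λ² E*)` of `β ∈ Γ(E*)`, as a bilinear form on each fibre,
given as the linear map
`u ↦ i_u d^E β`. It is characterized by `(d^E β)(σ, γ) = ρ(σ)(β(γ)) - ρ(γ)(β(σ)) - β(⟦σ, γ⟧)` for sections `σ, γ`. -/
def dForm (β : Sec EQ (F →L[ℝ] ℝ) (Dual E)) (q : Q) : E q →ₗ[ℝ] Dual E q :=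
  (A.exists_dForm β q).choose

theorem dForm_apply (β : Sec EQ (F →L[ℝ] ℝ) (Dual E)) (q : Q) (σ γ : Sec EQ F E) :
    A.dForm β q (σ q) (γ q) = A.cartan β q σ γ :=
  (A.exists_dForm β q).choose_spec σ γ

theorem dForm_skew (β : Sec EQ (F →L[ℝ] ℝ) (Dual E)) (q : Q) (u v : E q) :
    A.dForm β q u v = -A.dForm β q v u := by
  obtain ⟨σ, rfl⟩ := exists_sec (EQ := EQ) (F := F) q u
  obtain ⟨γ, rfl⟩ := exists_sec (EQ := EQ) (F := F) q v
  rw [dForm_apply, dForm_apply, cartan_skew]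

/-- `β` is a 1-cocycle: `d^E β = 0`. -/
def IsCocycle (β : Sec EQ (F →L[ℝ] ℝ) (Dual E)) : Prop := ∀ q, A.dForm β q = 0

end SkewAlgebroid

end Algebroid
section Restrict

variable {EQ : Type*} [NormedAddCommGroup EQ] [NormedSpace ℝ EQ] [FiniteDimensional ℝ EQ]
  {Q : Type*} [TopologicalSpace Q] [ChartedSpace EQ Q] [IsManifold 𝓘(ℝ, EQ) ∞ Q] [T2Space Q]
  {F : Type*} [NormedAddCommGroup F] [NormedSpace ℝ F] [FiniteDimensional ℝ F]
  {E : Q → Type*} [TopologicalSpace (TotalSpace F E)] [∀ q, TopologicalSpace (E q)]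
  [∀ q, AddCommGroup (E q)] [∀ q, Module ℝ (E q)] [FiberBundle F E] [VectorBundle ℝ F E]
  [ContMDiffVectorBundle ∞ F E 𝓘(ℝ, EQ)]

variable (φ : NonvanishingForm EQ F E)

theorem exists_kerTriv (q : Q) : ∃ A : F ≃L[ℝ] KerModel F × ℝ,
    q ∈ kerBase φ (trivializationAt F E q) A ∧
    ∀ p : TotalSpace (KerModel F) (Ker φ), (trivializationAt (KerModel F) (Ker φ) q p).2 =
      (A (trivializationAt F E q ⟨p.1, incl φ p.1 p.2⟩).2).1 :=
  ⟨_, (exists_pivot φ (trivializationAt F E q) q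
    (mem_baseSet_trivializationAt F E q)).choose_spec, fun _ => rfl⟩

/-- A smooth section of `E` with values in `V` is a smooth section of `V`. -/
theorem contMDiff_of_incl (s : ∀ q, Ker φ q)
    (hs : ContMDiff 𝓘(ℝ, EQ) (𝓘(ℝ, EQ).prod 𝓘(ℝ, F)) ∞
      (fun q => TotalSpace.mk' F q (incl φ q (s q)))) :
    ContMDiff 𝓘(ℝ, EQ) (𝓘(ℝ, EQ).prod 𝓘(ℝ, KerModel F)) ∞
      (fun q => TotalSpace.mk' (KerModel F) q (s q)) := by
  intro q
  obtain ⟨A, -, hA⟩ := exists_kerTriv φ q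
  rw [contMDiffAt_section]
  have h := (contMDiffAt_section q).1 (hs q)
  have h2 := ContMDiffAt.clm_apply (contMDiffAt_const
    (c := (ContinuousLinearMap.fst ℝ (KerModel F) ℝ).comp (A : F →L[ℝ] KerModel F × ℝ))) h
  exact h2.congr_of_eventuallyEq (Filter.Eventually.of_forall fun x => hA ⟨x, s x⟩)

/-- The inclusion `V → E` is smooth. -/
theorem contMDiff_incl : ContMDiff (𝓘(ℝ, EQ).prod 𝓘(ℝ, KerModel F)) (𝓘(ℝ, EQ).prod 𝓘(ℝ, F)) ∞
    (fun v : TotalSpace (KerModel F) (Ker φ) => TotalSpace.mk' F v.1 (incl φ v.1 v.2)) := by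
  intro v₀
  obtain ⟨A, hq, hA⟩ := exists_kerTriv φ v₀.1
  set e := trivializationAt F E v₀.1 with he
  have hid : ContMDiffAt (𝓘(ℝ, EQ).prod 𝓘(ℝ, KerModel F)) (𝓘(ℝ, EQ).prod 𝓘(ℝ, KerModel F)) ∞
    (fun v : TotalSpace (KerModel F) (Ker φ) => v) v₀ := contMDiffAt_id
  rw [contMDiffAt_totalSpace] at hid ⊢
  refine ⟨hid.1, ?_⟩
  have hl : ContMDiffAt (𝓘(ℝ, EQ).prod 𝓘(ℝ, KerModel F)) 𝓘(ℝ, F →L[ℝ] ℝ) ∞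
      (fun v : TotalSpace (KerModel F) (Ker φ) => (φ.sec v.1).comp (e.symmL ℝ v.1)) v₀ :=
    ContMDiffAt.comp v₀ (g := fun q => (φ.sec q).comp (e.symmL ℝ q))
      ((smooth_form φ e).contMDiffAt (e.open_baseSet.mem_nhds hq.1)) hid.1
  have hx := ContMDiffAt.clm_apply (contMDiffAt_const (c :=
    (A.symm : KerModel F × ℝ →L[ℝ] F).comp (ContinuousLinearMap.inl ℝ (KerModel F) ℝ))) hid.2
  have h1 := (hl.clm_apply (contMDiffAt_const (c := A.symm (0, 1)))).inv₀ hq.2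
  have h2 := hx.sub ((h1.smul (hl.clm_apply hx)).smul
    (contMDiffAt_const (I := 𝓘(ℝ, EQ).prod 𝓘(ℝ, KerModel F)) (I' := 𝓘(ℝ, F)) (c := A.symm (0, 1))))
  refine h2.congr_of_eventuallyEq ?_
  have hev : ∀ᶠ v in 𝓝 v₀, v.1 ∈ kerBase φ e A :=
    (FiberBundle.continuous_proj (KerModel F) (Ker φ)).continuousAt.eventually
      ((isOpen_kerBase φ e A).mem_nhds hq)
  filter_upwards [hev] with v hv
  change (e ⟨v.1, incl φ v.1 v.2⟩).2 = _
  have hk : kerSymm φ e A v.1 (trivializationAt (KerModel F) (Ker φ) v₀.1 v).2 = v.2 := by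
    rw [hA]
    have := (kerTriv φ e A).left_inv (x := v) hv
    exact TotalSpace.mk_injective v.1 this
  have h3 := incl_kerSymm φ e A v.1 (trivializationAt (KerModel F) (Ker φ) v₀.1 v).2 hv.2
  rw [hk] at h3
  rw [h3, pivot, ← map_smul, ← map_sub, e.symmL_apply hv.1, e.apply_mk_symm hv.1]
  simp [div_eq_inv_mul, e.symmL_apply hv.1]

/-- A section of `V` as a section of `E`. -/
def inclSec (s : Sec EQ (KerModel F) (Ker φ)) : Sec EQ F E :=
  ⟨fun q => incl φ q (s q), (contMDiff_incl φ).comp s.contMDiff⟩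

/-- A section of `E` annihilated by `φ` as a section of `V`. -/
def corestrict (s : Sec EQ F E) (hs : ∀ q, φ.sec q (s q) = 0) : Sec EQ (KerModel F) (Ker φ) :=
  ⟨fun q => Ker.mk φ (s q) (hs q), contMDiff_of_incl φ _ s.contMDiff⟩

theorem inclSec_injective : Function.Injective (inclSec φ) := fun s t h =>
  ContMDiffSection.ext fun q => incl_injective φ q
    (congrArg (fun σ : Sec EQ F E => σ q) h)

theorem SkewAlgebroid.bracket_mem (A : SkewAlgebroid EQ Q F E) (hφ : A.IsCocycle φ.sec)
    (s t : Sec EQ (KerModel F) (Ker φ)) (q : Q) :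
    φ.sec q (A.bracket (inclSec φ s) (inclSec φ t) q) = 0 := by
  have h := A.dForm_apply φ.sec q (inclSec φ s) (inclSec φ t)
  have h0 : ∀ s : Sec EQ (KerModel F) (Ker φ),
      dif 𝓘(ℝ, EQ) (pair φ.sec (inclSec φ s)) q = 0 := by
    intro s
    have : pair φ.sec (inclSec φ s) = fun _ => 0 := funext fun x => apply_incl φ x (s x)
    rw [this]
    exact mfderiv_const
  rw [hφ q] at h
  simp only [cartan, dFun, h0] at h
  simpa [pair] using h

/-- The skew-symmetric algebroid structure of `V = ker φ` for a 1-cocycle `φ`: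
`i_V ⟦σ, γ⟧_V = ⟦i_V σ, i_V γ⟧` and `ρ_V = ρ ∘ i_V`. -/
def SkewAlgebroid.restrict (A : SkewAlgebroid EQ Q F E) (hφ : A.IsCocycle φ.sec) :
    SkewAlgebroid EQ Q (KerModel F) (Ker φ) where
  bracket := LinearMap.mk₂ ℝ
    (fun s t => corestrict φ (A.bracket (inclSec φ s) (inclSec φ t)) (A.bracket_mem φ hφ s t))
    (fun s s' t => inclSec_injective φ (by
      change A.bracket (inclSec φ s + inclSec φ s') (inclSec φ t) = 
        A.bracket (inclSec φ s) (inclSec φ t) + A.bracket (inclSec φ s') (inclSec φ t)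
      rw [map_add]; rfl))
    (fun c s t => inclSec_injective φ (by
      change A.bracket (c • inclSec φ s) (inclSec φ t) = c • A.bracket (inclSec φ s) (inclSec φ t)
      rw [map_smul]; rfl))
    (fun s t t' => inclSec_injective φ (by
      change A.bracket (inclSec φ s) (inclSec φ t + inclSec φ t') = 
        A.bracket (inclSec φ s) (inclSec φ t) + A.bracket (inclSec φ s) (inclSec φ t')
      rw [map_add]))
    (fun c s t => inclSec_injective φ (by
      change A.bracket (inclSec φ s) (c • inclSec φ t) = c • A.bracket (inclSec φ s) (inclSec φ t)
      rw [map_smul]))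
  anchor q := (A.anchor q).comp (incl φ q)
  contMDiff_anchor := A.contMDiff_anchor.comp (contMDiff_incl φ)
  skew _ _ := inclSec_injective φ (A.skew _ _)
  leibniz s t f q := incl_injective φ q (A.leibniz (inclSec φ s) (inclSec φ t) f q)

end Restrict
section Poisson

variable {EQ : Type*} [NormedAddCommGroup EQ] [NormedSpace ℝ EQ] [FiniteDimensional ℝ EQ]
  {Q : Type*} [TopologicalSpace Q] [ChartedSpace EQ Q] [IsManifold 𝓘(ℝ, EQ) ∞ Q] [T2Space Q]
  {F : Type*} [NormedAddCommGroup F] [NormedSpace ℝ F] [FiniteDimensional ℝ F]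
  {E : Q → Type*} [TopologicalSpace (TotalSpace F E)] [∀ q, TopologicalSpace (E q)]
  [∀ q, AddCommGroup (E q)] [∀ q, Module ℝ (E q)] [FiberBundle F E] [VectorBundle ℝ F E]
  [ContMDiffVectorBundle ∞ F E 𝓘(ℝ, EQ)]

variable (F E) in
/-- The total space of the dual bundle `E*`. -/
abbrev DualTot : Type _ := TotalSpace (F →L[ℝ] ℝ) (Dual E)

variable (EQ F) in
/-- The model with corners of the manifold `E*`. -/
abbrev dualModel : ModelWithCorners ℝ (EQ × (F →L[ℝ] ℝ)) (ModelProd EQ (F →L[ℝ] ℝ)) :=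
  𝓘(ℝ, EQ).prod 𝓘(ℝ, F →L[ℝ] ℝ)

/-- The vertical lift `ξ^∨_α ∈ T_α E*` of `ξ ∈ E*_q` at `α ∈ E*_q`: the velocity at `t = 0` of
the curve `t ↦ α + t ξ` in the fibre. -/
def vlift (α : DualTot F E) (ξ : Dual E α.1) : TangentSpace (dualModel EQ F) α :=
  mfderiv 𝓘(ℝ, ℝ) (dualModel EQ F) (fun t : ℝ => (⟨α.1, α.2 + t • ξ⟩ : DualTot F E)) 0 (1 : ℝ)

theorem hasMFDerivAt_line (α : DualTot F E) (ξ : Dual E α.1) :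
    HasMFDerivAt 𝓘(ℝ, ℝ) (dualModel EQ F) (fun t : ℝ => (⟨α.1, α.2 + t • ξ⟩ : DualTot F E)) 0
      (ContinuousLinearMap.toSpanSingleton ℝ
        ((0, (trivializationAt (F →L[ℝ] ℝ) (Dual E) α.1).continuousLinearMapAt ℝ α.1 ξ) :
          EQ × (F →L[ℝ] ℝ))) := by
  set e := trivializationAt (F →L[ℝ] ℝ) (Dual E) α.1 with he
  have hq : α.1 ∈ e.baseSet := mem_baseSet_trivializationAt (F →L[ℝ] ℝ) (Dual E) α.1
  refine ⟨?_, ?_⟩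
  · have h1 : Continuous fun t : ℝ => α.2 + t • ξ := by fun_prop
    exact ((FiberBundle.continuous_totalSpaceMk (F →L[ℝ] ℝ) (Dual E) α.1).comp h1).continuousAt
  · have h1 : writtenInExtChartAt 𝓘(ℝ, ℝ) (dualModel EQ F) 0
        (fun t : ℝ => (⟨α.1, α.2 + t • ξ⟩ : DualTot F E)) =
        fun t : ℝ => (extChartAt 𝓘(ℝ, EQ) α.1 α.1,
          e.continuousLinearMapAt ℝ α.1 α.2 + t • e.continuousLinearMapAt ℝ α.1 ξ) := by
      ext1 t
      have h2 : e.continuousLinearMapAt ℝ α.1 α.2 + t • e.continuousLinearMapAt ℝ α.1 ξ =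
          (e ⟨α.1, α.2 + t • ξ⟩).2 := by
        rw [← map_smul, ← map_add, Trivialization.continuousLinearMapAt_apply ℝ e,
          e.coe_linearMapAt_of_mem hq]
      rw [h2]
      change extChartAt (𝓘(ℝ, EQ).prod 𝓘(ℝ, F →L[ℝ] ℝ))
        (⟨α.1, α.2 + (0 : ℝ) • ξ⟩ : DualTot F E) ⟨α.1, α.2 + t • ξ⟩ = _
      rw [FiberBundle.extChartAt]
      change (extChartAt 𝓘(ℝ, EQ) α.1 (e ⟨α.1, α.2 + t • ξ⟩).1, (e ⟨α.1, α.2 + t • ξ⟩).2) = _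
      rw [show (e ⟨α.1, α.2 + t • ξ⟩).1 = α.1 from e.coe_fst' hq]
    rw [h1]
    have h3 : HasFDerivAt (fun t : ℝ => ((extChartAt 𝓘(ℝ, EQ) α.1 α.1,
          e.continuousLinearMapAt ℝ α.1 α.2 + t • e.continuousLinearMapAt ℝ α.1 ξ) :
            EQ × (F →L[ℝ] ℝ)))
        (ContinuousLinearMap.toSpanSingleton ℝ ((0, e.continuousLinearMapAt ℝ α.1 ξ) :
          EQ × (F →L[ℝ] ℝ))) 0 := by
      have h4 : HasDerivAt (fun t : ℝ => e.continuousLinearMapAt ℝ α.1 α.2 +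
          t • e.continuousLinearMapAt ℝ α.1 ξ) (e.continuousLinearMapAt ℝ α.1 ξ) 0 := by
        simpa using ((hasDerivAt_id (0 : ℝ)).smul_const
          (e.continuousLinearMapAt ℝ α.1 ξ)).const_add (e.continuousLinearMapAt ℝ α.1 α.2)
      exact ((hasDerivAt_const (0 : ℝ) (extChartAt 𝓘(ℝ, EQ) α.1 α.1)).prodMk h4).hasFDerivAt
    exact h3.hasFDerivWithinAt

theorem vlift_eq (α : DualTot F E) (ξ : Dual E α.1) :
    (vlift α ξ : TangentSpace (dualModel EQ F) α) =
      ((0, (trivializationAt (F →L[ℝ] ℝ) (Dual E) α.1).continuousLinearMapAt ℝ α.1 ξ) :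
          EQ × (F →L[ℝ] ℝ)) := by
  rw [vlift, (hasMFDerivAt_line α ξ).mfderiv]
  exact one_smul ℝ _

theorem dif_vlift {G : DualTot F E → ℝ} (α : DualTot F E)
    (hG : MDifferentiableAt (dualModel EQ F) 𝓘(ℝ, ℝ) G α) (ξ : Dual E α.1) :
    dif (dualModel EQ F) G α (vlift α ξ) = deriv (fun t : ℝ => G ⟨α.1, α.2 + t • ξ⟩) 0 := by
  have h0 : (⟨α.1, α.2 + (0 : ℝ) • ξ⟩ : DualTot F E) = α := by simp
  have h := mfderiv_comp_of_eq (x := (0 : ℝ))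
    (f := fun t : ℝ => (⟨α.1, α.2 + t • ξ⟩ : DualTot F E)) hG
    (hasMFDerivAt_line α ξ).mdifferentiableAt h0
  have h' := congrArg (fun l : ℝ →L[ℝ] ℝ => l 1) h
  rw [← fderiv_apply_one_eq_deriv, ← mfderiv_eq_fderiv]
  refine Eq.trans ?_ h'.symm
  change _ = mfderiv (dualModel EQ F) 𝓘(ℝ, ℝ) G ⟨α.1, α.2 + (0 : ℝ) • ξ⟩ (vlift α ξ)
  rw [h0]
  rfl

/-- The linear function `σ̂ : E* → ℝ` of a section `σ` of `E`. -/
def lin (σ : Sec EQ F E) (α : DualTot F E) : ℝ := α.2 (σ α.1)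

theorem contMDiff_lin (σ : Sec EQ F E) : ContMDiff (dualModel EQ F) 𝓘(ℝ, ℝ) ∞ (lin σ) := by
  have h := ContMDiff.clm_bundle_apply (IM := dualModel EQ F) (F₁ := F) (E₁ := E) (F₂ := ℝ)
    (E₂ := fun _ : Q => ℝ) (n := ∞) (b := fun α : DualTot F E => α.1)
    (ϕ := fun α : DualTot F E => α.2) (v := fun α => σ α.1) contMDiff_id
    (σ.contMDiff.comp (contMDiff_proj (Dual E)))
  intro α
  exact (contMDiffAt_totalSpace.1 (h α)).2

/-- The covectors on `E*` at `α`. -/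
abbrev Cot (EQ : Type*) [NormedAddCommGroup EQ] [NormedSpace ℝ EQ] [ChartedSpace EQ Q]
    (α : DualTot F E) : Type _ := TangentSpace (dualModel EQ F) α →L[ℝ] ℝ

theorem hasMFDerivAt_proj (α : DualTot F E) :
    HasMFDerivAt (dualModel EQ F) 𝓘(ℝ, EQ) (fun α : DualTot F E => α.1) α
      (ContinuousLinearMap.fst ℝ EQ (F →L[ℝ] ℝ)) := by
  refine ⟨(FiberBundle.continuous_proj (F →L[ℝ] ℝ) (Dual E)).continuousAt, ?_⟩
  have h : writtenInExtChartAt (dualModel EQ F) 𝓘(ℝ, EQ) α (fun α : DualTot F E => α.1)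
      =ᶠ[𝓝 (extChartAt (dualModel EQ F) α α)] Prod.fst := by
    filter_upwards [extChartAt_target_mem_nhds (I := dualModel EQ F) α] with y hy
    have hy' := hy
    rw [FiberBundle.extChartAt_target] at hy'
    rw [writtenInExtChartAt, FiberBundle.extChartAt]
    have h1 : ((trivializationAt (F →L[ℝ] ℝ) (Dual E) α.1).toPartialEquiv.symm
        ((extChartAt 𝓘(ℝ, EQ) α.1).symm y.1, y.2)).proj = (extChartAt 𝓘(ℝ, EQ) α.1).symm y.1 :=
      (trivializationAt (F →L[ℝ] ℝ) (Dual E) α.1).proj_symm_apply' hy'.1.2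
    refine (congrArg (extChartAt 𝓘(ℝ, EQ) α.1) h1).trans ?_
    exact (extChartAt 𝓘(ℝ, EQ) α.1).right_inv hy'.1.1
  exact ((hasFDerivAt_fst (𝕜 := ℝ)).congr_of_eventuallyEq h).hasFDerivWithinAt

/-- Every covector at `q` is the differential of a smooth function. -/
theorem exists_dif_eq (q : Q) (θ : TangentSpace 𝓘(ℝ, EQ) q →L[ℝ] ℝ) :
    ∃ f : SmoothFun EQ Q, dif 𝓘(ℝ, EQ) f q = θ := by
  obtain ⟨ψ, h1, h2⟩ := exists_bump (EQ := EQ) q (chart_source_mem_nhds EQ q)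
  let θ' : EQ →L[ℝ] ℝ := θ
  let g : Q → ℝ := fun x => θ' (extChartAt 𝓘(ℝ, EQ) q x - extChartAt 𝓘(ℝ, EQ) q q)
  have hg : ∀ x ∈ (chartAt EQ q).source, ContMDiffAt 𝓘(ℝ, EQ) 𝓘(ℝ, ℝ) ∞ g x := fun x hx =>
    (contMDiffAt_const (c := θ')).clm_apply ((contMDiffAt_extChartAt' hx).sub contMDiffAt_const)
  have hg' := hg q (mem_chart_source EQ q)
  have hf : ContMDiff 𝓘(ℝ, EQ) 𝓘(ℝ, ℝ) ∞ (fun x => ψ x * g x) :=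
    contMDiff_of_tsupport fun x hx =>
      ψ.contMDiff.contMDiffAt.mul (hg x (h2 (tsupport_mul_subset_left hx)))
  have hgd : HasMFDerivAt 𝓘(ℝ, EQ) 𝓘(ℝ, ℝ) g q θ' := by
    refine ⟨hg'.continuousAt, ?_⟩
    have h : writtenInExtChartAt 𝓘(ℝ, EQ) 𝓘(ℝ, ℝ) q g
        =ᶠ[𝓝 (extChartAt 𝓘(ℝ, EQ) q q)] fun y => θ' (y - extChartAt 𝓘(ℝ, EQ) q q) := by
      filter_upwards [extChartAt_target_mem_nhds (I := 𝓘(ℝ, EQ)) q] with y hy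
      change θ' (extChartAt 𝓘(ℝ, EQ) q ((extChartAt 𝓘(ℝ, EQ) q).symm y) - _) = _
      rw [(extChartAt 𝓘(ℝ, EQ) q).right_inv hy]
    have h3 : HasFDerivAt (fun y => θ' (y - extChartAt 𝓘(ℝ, EQ) q q)) θ'
        (extChartAt 𝓘(ℝ, EQ) q q) :=
      θ'.hasFDerivAt.comp (extChartAt 𝓘(ℝ, EQ) q q) ((hasFDerivAt_id _).sub_const _)
    exact (h3.congr_of_eventuallyEq h).hasFDerivWithinAt
  refine ⟨⟨_, hf⟩, ?_⟩
  change dif 𝓘(ℝ, EQ) (fun x => ψ x * g x) q = θ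
  rw [dif_mul (ψ.contMDiff.mdifferentiableAt (by simp)) (hg'.mdifferentiableAt (by simp)), h1,
    show g q = 0 by simp [g], one_smul, zero_smul, add_zero]
  exact hgd.mfderiv

theorem dif_lin_vlift (σ : Sec EQ F E) (α : DualTot F E) (ξ : Dual E α.1) :
    dif (dualModel EQ F) (lin σ) α (vlift α ξ) = ξ (σ α.1) := by
  rw [dif_vlift α ((contMDiff_lin σ).mdifferentiableAt (by simp))]
  have h : (fun t : ℝ => lin σ (⟨α.1, α.2 + t • ξ⟩ : DualTot F E)) =
      fun t => α.2 (σ α.1) + t * ξ (σ α.1) := rfl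
  rw [h]
  simp

theorem dif_base (f : SmoothFun EQ Q) (α : DualTot F E)
    (X : TangentSpace (dualModel EQ F) α) :
    dif (dualModel EQ F) (fun α : DualTot F E => f α.1) α X =
      dif 𝓘(ℝ, EQ) f α.1 (X : EQ × (F →L[ℝ] ℝ)).1 := by
  have h := ((f.contMDiff.mdifferentiableAt (x := α.1) (by simp)).hasMFDerivAt.comp α
    (hasMFDerivAt_proj α)).mfderiv
  exact congrArg (fun l => l X) h

theorem dif_base_vlift (f : SmoothFun EQ Q) (α : DualTot F E) (ξ : Dual E α.1) :
    dif (dualModel EQ F) (fun α : DualTot F E => f α.1) α (vlift α ξ) = 0 := by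
  rw [dif_base, vlift_eq]
  exact map_zero _

/-- A finite-dimensional space is canonically isomorphic to its bidual. -/
def bidual (X : Type*) [AddCommGroup X] [Module ℝ X] [TopologicalSpace X]
    [IsTopologicalAddGroup X] [ContinuousSMul ℝ X] [T2Space X] [FiniteDimensional ℝ X] :
    X ≃ₗ[ℝ] ((X →L[ℝ] ℝ) →ₗ[ℝ] ℝ) :=
  (Module.evalEquiv ℝ X).trans
    (LinearMap.toContinuousLinearMap (𝕜 := ℝ) (E := X) (F' := ℝ)).symm.dualMap

theorem apply_bidual_symm {X : Type*} [AddCommGroup X] [Module ℝ X] [TopologicalSpace X]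
    [IsTopologicalAddGroup X] [ContinuousSMul ℝ X] [T2Space X] [FiniteDimensional ℝ X]
    (L : (X →L[ℝ] ℝ) →ₗ[ℝ] ℝ) (ξ : X →L[ℝ] ℝ) : ξ ((bidual X).symm L) = L ξ := by
  conv_rhs => rw [← (bidual X).apply_symm_apply L]
  rfl

/-- The canonical isomorphism `(E*_q)* ≅ E_q`. -/
def fibreBidual (q : Q) : E q ≃ₗ[ℝ] (Dual E q →ₗ[ℝ] ℝ) :=
  haveI : T2Space (E q) := FiberBundle.t2Space F E q
  haveI : FiniteDimensional ℝ (E q) := VectorBundle.finiteDimensional ℝ F E q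
  haveI : IsTopologicalAddGroup (E q) :=
    (VectorBundle.continuousLinearEquivAt ℝ F E q).toContinuousAddEquiv.isTopologicalAddGroup
  haveI : ContinuousSMul ℝ (E q) :=
    (VectorBundle.continuousLinearEquivAt ℝ F E q).continuousSMul
  bidual (E q)

theorem apply_fibreBidual_symm (q : Q) (L : Dual E q →ₗ[ℝ] ℝ) (ξ : Dual E q) :
    ξ ((fibreBidual (F := F) q).symm L) = L ξ :=
  haveI : T2Space (E q) := FiberBundle.t2Space F E q
  haveI : FiniteDimensional ℝ (E q) := VectorBundle.finiteDimensional ℝ F E q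
  haveI : IsTopologicalAddGroup (E q) :=
    (VectorBundle.continuousLinearEquivAt ℝ F E q).toContinuousAddEquiv.isTopologicalAddGroup
  haveI : ContinuousSMul ℝ (E q) :=
    (VectorBundle.continuousLinearEquivAt ℝ F E q).continuousSMul
  apply_bidual_symm L ξ

instance {EM HM M : Type*} [NormedAddCommGroup EM] [NormedSpace ℝ EM] [FiniteDimensional ℝ EM]
    [TopologicalSpace HM] (I : ModelWithCorners ℝ EM HM) [TopologicalSpace M] [ChartedSpace HM M]
    (x : M) : FiniteDimensional ℝ (TangentSpace I x) := inferInstanceAs (FiniteDimensional ℝ EM)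

instance {EM HM M : Type*} [NormedAddCommGroup EM] [NormedSpace ℝ EM]
    [TopologicalSpace HM] (I : ModelWithCorners ℝ EM HM) [TopologicalSpace M] [ChartedSpace HM M]
    (x : M) : T2Space (TangentSpace I x) := inferInstanceAs (T2Space EM)

/-- The vertical lift at `α ∈ E*_q` as a linear map `E*_q → T_α E*`. -/
def vliftL (α : DualTot F E) : Dual E α.1 →ₗ[ℝ] TangentSpace (dualModel EQ F) α where
  toFun := vlift α
  map_add' ξ η := by
    rw [vlift_eq, vlift_eq, vlift_eq, map_add]
    exact Prod.ext (add_zero _).symm rfl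
  map_smul' c ξ := by
    rw [vlift_eq, vlift_eq, map_smul]
    exact Prod.ext (smul_zero c).symm rfl

/-- The element `w̃ ∈ E_q` determined by a covector `w ∈ T*_α E*` at `α ∈ E*_q` through
`ξ(w̃) = w(ξ^∨_α)` for `ξ ∈ E*_q`. -/
def tilde (α : DualTot F E) : Cot EQ α →ₗ[ℝ] E α.1 where
  toFun w := (fibreBidual (F := F) α.1).symm (w.toLinearMap ∘ₗ vliftL α)
  map_add' w η := by rw [← map_add]; rfl
  map_smul' c w := by rw [RingHom.id_apply, ← map_smul]; rfl

theorem apply_tilde (α : DualTot F E) (w : Cot EQ α) (ξ : Dual E α.1) :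
    ξ (tilde α w) = w (vlift α ξ) :=
  apply_fibreBidual_symm (F := F) α.1 _ ξ

theorem tilde_lin (σ : Sec EQ F E) (α : DualTot F E) :
    tilde α (dif (dualModel EQ F) (lin σ) α) = σ α.1 :=
  (fibreBidual (F := F) α.1).injective <| LinearMap.ext fun ξ =>
    (apply_tilde α _ ξ).trans (dif_lin_vlift σ α ξ)

theorem tilde_base (f : SmoothFun EQ Q) (α : DualTot F E) :
    tilde α (dif (dualModel EQ F) (fun α : DualTot F E => f α.1) α) = 0 :=
  (fibreBidual (F := F) α.1).injective <| LinearMap.ext fun ξ =>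
    show ξ (tilde α (dif (dualModel EQ F) (fun α : DualTot F E => f α.1) α)) = ξ 0 by
      rw [apply_tilde, dif_base_vlift, map_zero]

theorem exists_cot_eq (α : DualTot F E) (w : Cot EQ α) :
    ∃ (σ : Sec EQ F E) (f : SmoothFun EQ Q), w = dif (dualModel EQ F) (lin σ) α +
      dif (dualModel EQ F) (fun α : DualTot F E => f α.1) α := by
  obtain ⟨σ, hσ⟩ := exists_sec (EQ := EQ) (F := F) α.1 (tilde α w)
  set η : Cot EQ α := w - dif (dualModel EQ F) (lin σ) α with hη
  have hv : ∀ ξ, η (vlift α ξ) = 0 := fun ξ => by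
    rw [hη]
    change w (vlift α ξ) - dif (dualModel EQ F) (lin σ) α (vlift α ξ) = 0
    rw [dif_lin_vlift, hσ, apply_tilde, sub_self]
  have hv' : ∀ b : F →L[ℝ] ℝ, η ((0, b) : EQ × (F →L[ℝ] ℝ)) = 0 := fun b => by
    set e := trivializationAt (F →L[ℝ] ℝ) (Dual E) α.1 with he
    have hq : α.1 ∈ e.baseSet := mem_baseSet_trivializationAt (F →L[ℝ] ℝ) (Dual E) α.1
    have := hv (e.symmL ℝ α.1 b)
    rw [vlift_eq] at this
    rwa [e.continuousLinearMapAt_symmL hq] at this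
  obtain ⟨f, hf⟩ := exists_dif_eq α.1
    ((η : EQ × (F →L[ℝ] ℝ) →L[ℝ] ℝ).comp (ContinuousLinearMap.inl ℝ EQ (F →L[ℝ] ℝ)))
  refine ⟨σ, f, ?_⟩
  rw [← sub_eq_iff_eq_add', ← hη]
  ext X
  rw [dif_base, hf]
  change η X = η ((X : EQ × (F →L[ℝ] ℝ)).1, 0)
  have : X = (((X : EQ × (F →L[ℝ] ℝ)).1, 0) + (0, (X : EQ × (F →L[ℝ] ℝ)).2) :
    EQ × (F →L[ℝ] ℝ)) := Prod.ext (add_zero _).symm (zero_add _).symm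
  conv_lhs => rw [this]
  refine (map_add η _ _).trans ?_
  rw [hv', add_zero]

namespace SkewAlgebroid

variable (A : SkewAlgebroid EQ Q F E)

/-- The relations which characterize the linear almost Poisson bivector `Π` of `E*` at `α`:
`Π` is skew-symmetric and `{σ̂, γ̂} = -⟦σ, γ⟧^`, `{f ∘ τ, σ̂} = ρ(σ)(f) ∘ τ`,
`{f ∘ τ, g ∘ τ} = 0`, where `{F, G} = Π(dF, dG)`. -/
structure IsBivectorAt (α : DualTot F E) (P : Cot EQ α →ₗ[ℝ] Cot EQ α →ₗ[ℝ] ℝ) : Prop where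
  skew : ∀ w η, P w η = -P η w
  lin_lin : ∀ σ γ : Sec EQ F E, P (dif (dualModel EQ F) (lin σ) α)
    (dif (dualModel EQ F) (lin γ) α) = -lin (A.bracket σ γ) α
  base_lin : ∀ (f : SmoothFun EQ Q) (σ : Sec EQ F E),
    P (dif (dualModel EQ F) (fun α : DualTot F E => f α.1) α)
      (dif (dualModel EQ F) (lin σ) α) = A.dFun f α.1 (σ α.1)
  base_base : ∀ f g : SmoothFun EQ Q,
    P (dif (dualModel EQ F) (fun α : DualTot F E => f α.1) α)
      (dif (dualModel EQ F) (fun α : DualTot F E => g α.1) α) = 0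

theorem exists_bivector (α : DualTot F E) : ∃ P, A.IsBivectorAt α P := by
  obtain ⟨q, a⟩ := α
  obtain ⟨β, rfl⟩ := exists_sec (EQ := EQ) (F := F →L[ℝ] ℝ) (E := Dual E) q a
  set α : DualTot F E := ⟨q, β q⟩ with hα
  let s : Q → DualTot F E := fun x => ⟨x, β x⟩
  have hs : MDifferentiableAt 𝓘(ℝ, EQ) (dualModel EQ F) s q :=
    β.contMDiff.mdifferentiableAt (by simp)
  let S : Cot EQ α →ₗ[ℝ] Dual E q :=
    { toFun := fun w => (w.comp (mfderiv 𝓘(ℝ, EQ) (dualModel EQ F) s q)).comp (A.anchor q)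
      map_add' := fun w η => rfl
      map_smul' := fun c w => rfl }
  have hS : ∀ G : DualTot F E → ℝ, MDifferentiableAt (dualModel EQ F) 𝓘(ℝ, ℝ) G α →
      S (dif (dualModel EQ F) G α) = A.dFun (G ∘ s) q := fun G hG => by
    have h := mfderiv_comp q (g := G) (f := s) hG hs
    change ((dif (dualModel EQ F) G α).comp (mfderiv 𝓘(ℝ, EQ) (dualModel EQ F) s q)).comp
      (A.anchor q) = (dif 𝓘(ℝ, EQ) (G ∘ s) q).comp (A.anchor q)
    congr 1
    exact h.symm
  let P : Cot EQ α →ₗ[ℝ] Cot EQ α →ₗ[ℝ] ℝ := LinearMap.mk₂ ℝ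
    (fun w η => S w (tilde α η) - S η (tilde α w) + A.dForm β q (tilde α w) (tilde α η))
    (fun w w' η => by simp only [map_add, _root_.add_apply]; ring)
    (fun c w η => by simp only [map_smul, _root_.smul_apply, smul_eq_mul]; ring)
    (fun w η η' => by simp only [map_add, _root_.add_apply]; ring)
    (fun c w η => by simp only [map_smul, _root_.smul_apply, smul_eq_mul]; ring)
  have hP : ∀ w η, P w η = S w (tilde α η) - S η (tilde α w) +
    A.dForm β q (tilde α w) (tilde α η) := fun _ _ => rfl
  have hl : ∀ σ : Sec EQ F E, S (dif (dualModel EQ F) (lin σ) α) = A.dFun (pair β σ) q :=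
    fun σ => hS _ ((contMDiff_lin σ).mdifferentiableAt (by simp))
  have hb : ∀ f : SmoothFun EQ Q, S (dif (dualModel EQ F) (fun α : DualTot F E => f α.1) α) =
      A.dFun f q :=
    fun f => hS _ ((f.contMDiff.comp (contMDiff_proj (Dual E))).mdifferentiableAt (by simp))
  refine ⟨P, ⟨fun w η => ?_, fun σ γ => ?_, fun f σ => ?_, fun f g => ?_⟩⟩
  · rw [hP, hP, A.dForm_skew β q (tilde α w)]; ring
  · rw [hP, hl, hl, tilde_lin, tilde_lin]
    change _ - _ + A.dForm β q (σ q) (γ q) = -pair β (A.bracket σ γ) q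
    rw [dForm_apply, cartan]
    ring
  · rw [hP, hl, hb, tilde_lin, tilde_base]
    simp [α]
  · rw [hP, hb, hb, tilde_base, tilde_base]
    simp

theorem existsUnique_bivector (α : DualTot F E) : ∃! P, A.IsBivectorAt α P := by
  refine existsUnique_of_exists_of_unique (A.exists_bivector α) fun P P' h h' => ?_
  have key : ∀ w η, P w η = P' w η := by
    intro w η
    obtain ⟨σ, f, rfl⟩ := exists_cot_eq α w
    obtain ⟨γ, g, rfl⟩ := exists_cot_eq α η
    simp only [map_add, LinearMap.add_apply]
    rw [h.lin_lin, h.base_lin, h.base_base, h.skew (dif _ (lin σ) α), h.base_lin,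
      h'.lin_lin, h'.base_lin, h'.base_base, h'.skew (dif _ (lin σ) α), h'.base_lin]
  ext w η
  exact key w η

/-- The linear almost Poisson bivector `Π_{E*}` on `E*`. -/
def bivector (α : DualTot F E) : Cot EQ α →ₗ[ℝ] Cot EQ α →ₗ[ℝ] ℝ := (A.exists_bivector α).choose

theorem isBivectorAt_bivector (α : DualTot F E) : A.IsBivectorAt α (A.bivector α) :=
  (A.exists_bivector α).choose_spec

/-- The linear almost Poisson bracket `{G₁, G₂} = Π_{E*}(dG₁, dG₂)` of functions on `E*`. -/
def poisson (G₁ G₂ : DualTot F E → ℝ) (α : DualTot F E) : ℝ :=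
  A.bivector α (dif (dualModel EQ F) G₁ α) (dif (dualModel EQ F) G₂ α)

/-- The hamiltonian vector field `H_G = -i_{dG} Π_{E*}` of a function `G` on `E*`. -/
def hamVF (G : DualTot F E → ℝ) (α : DualTot F E) : TangentSpace (dualModel EQ F) α :=
  (bidual (TangentSpace (dualModel EQ F) α)).symm
    (-(A.bivector α (dif (dualModel EQ F) G α)))

theorem dif_hamVF (G₁ G₂ : DualTot F E → ℝ) (α : DualTot F E) :
    dif (dualModel EQ F) G₁ α (A.hamVF G₂ α) = A.poisson G₁ G₂ α := by
  rw [hamVF, apply_bidual_symm, poisson, (A.isBivectorAt_bivector α).skew]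
  rfl

end SkewAlgebroid

end Poisson

section Hamiltonian

variable {EQ : Type*} [NormedAddCommGroup EQ] [NormedSpace ℝ EQ] [FiniteDimensional ℝ EQ]
  {Q : Type*} [TopologicalSpace Q] [ChartedSpace EQ Q] [IsManifold 𝓘(ℝ, EQ) ∞ Q] [T2Space Q]
  {F : Type*} [NormedAddCommGroup F] [NormedSpace ℝ F] [FiniteDimensional ℝ F]
  {E : Q → Type*} [TopologicalSpace (TotalSpace F E)] [∀ q, TopologicalSpace (E q)]
  [∀ q, AddCommGroup (E q)] [∀ q, Module ℝ (E q)] [FiberBundle F E] [VectorBundle ℝ F E]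
  [ContMDiffVectorBundle ∞ F E 𝓘(ℝ, EQ)]

variable (φ : NonvanishingForm EQ F E)

/-- The projection `μ = i_V^* : E* → V*` as a map of manifolds. -/
def muTot (α : DualTot F E) : DualTot (KerModel F) (Ker φ) := ⟨α.1, muFib φ α.1 α.2⟩

/-- A smooth section `h : V* → E*` of `μ : E* → V*`, i.e. a smooth map with `μ ∘ h = id`. Such a
map covers the identity of `Q`, so it is given fibre by fibre; it need not be linear. -/
structure HamSection where
  /-- the section on the fibres over `q` -/
  toFun : ∀ q, Dual (Ker φ) q → Dual E q
  contMDiff' : ContMDiff (dualModel EQ (KerModel F)) (dualModel EQ F) ∞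
    (fun v : DualTot (KerModel F) (Ker φ) => (⟨v.1, toFun v.1 v.2⟩ : DualTot F E))
  mu_toFun : ∀ q v, muFib φ q (toFun q v) = v

variable {φ}

namespace HamSection

variable (h : HamSection φ)

/-- The section `h : V* → E*` as a map of manifolds. -/
def tot (v : DualTot (KerModel F) (Ker φ)) : DualTot F E := ⟨v.1, h.toFun v.1 v.2⟩

theorem muTot_tot (v : DualTot (KerModel F) (Ker φ)) : muTot φ (h.tot v) = v :=
  congrArg (TotalSpace.mk v.1) (h.mu_toFun v.1 v.2)

theorem existsUnique_fn (α : DualTot F E) :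
    ∃! r : ℝ, α.2 - h.toFun α.1 (muFib φ α.1 α.2) = r • φ.sec α.1 := by
  set η : Dual E α.1 := α.2 - h.toFun α.1 (muFib φ α.1 α.2) with hη
  have h0 : ∀ w : E α.1, φ.sec α.1 w = 0 → η w = 0 := fun w hw => by
    have h1 := congrArg (fun l : Dual (Ker φ) α.1 => l (Ker.mk φ w hw))
      (h.mu_toFun α.1 (muFib φ α.1 α.2))
    have h2 : h.toFun α.1 (muFib φ α.1 α.2) w = α.2 w := h1
    change α.2 w - h.toFun α.1 (muFib φ α.1 α.2) w = 0
    rw [h2, sub_self]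
  obtain ⟨u, hu⟩ : ∃ u, φ.sec α.1 u ≠ 0 := by
    by_contra hc
    push Not at hc
    exact φ.ne_zero α.1 (ContinuousLinearMap.ext hc)
  refine ⟨η u / φ.sec α.1 u, ?_, fun r hr => ?_⟩
  · ext w
    have h3 := h0 (w - (φ.sec α.1 w / φ.sec α.1 u) • u) (by
      rw [map_sub, map_smul, smul_eq_mul, div_mul_cancel₀ _ hu, sub_self])
    rw [map_sub, map_smul, smul_eq_mul, sub_eq_zero] at h3
    change η w = η u / φ.sec α.1 u * φ.sec α.1 w
    rw [h3]
    ring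
  · rw [hr]
    change r = r * φ.sec α.1 u / φ.sec α.1 u
    rw [mul_div_cancel_right₀ _ hu]

/-- The function `F_h : E* → ℝ` determined by `α - h(μ(α)) = F_h(α) φ(q)` for `α ∈ E*_q`. -/
def fn (α : DualTot F E) : ℝ := (h.existsUnique_fn α).choose

theorem fn_spec (α : DualTot F E) :
    α.2 - h.toFun α.1 (muFib φ α.1 α.2) = h.fn α • φ.sec α.1 :=
  (h.existsUnique_fn α).choose_spec.1

/-- The section `ζ_h^α = (dF_h)~` of `E` associated with a section `α` of `V*`:
`β(ζ_h^α) = dF_h(β^∨) ∘ h ∘ α` for all `β ∈ Γ(E*)`. -/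
def zeta (α : ∀ q, Dual (Ker φ) q) (q : Q) : E q :=
  tilde (⟨q, h.toFun q (α q)⟩ : DualTot F E) (dif (dualModel EQ F) h.fn ⟨q, h.toFun q (α q)⟩)

variable (A : SkewAlgebroid EQ Q F E)

/-- The hamiltonian vector field `R_h` on `V*`, characterized by `R_h ∘ μ = Tμ ∘ H_{F_h}`, where
`H_{F_h}` is the hamiltonian vector field of `F_h` on `E*`. As `φ` is a 1-cocycle,
`T_α μ (H_{F_h}(α))` depends only on `μ(α)`, and it is evaluated here at the point `α = h(v)` of
the fibre `μ⁻¹(v)`. -/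
def vf (v : DualTot (KerModel F) (Ker φ)) : TangentSpace (dualModel EQ (KerModel F)) v :=
  (mfderiv (dualModel EQ F) (dualModel EQ (KerModel F)) (muTot φ) (h.tot v)
    (A.hamVF h.fn (h.tot v)) :)

/-- The vector field `R_h^α = Tτ_{V*} ∘ R_h ∘ α` on `Q` associated with a section `α` of `V*`. -/
def baseVF (α : ∀ q, Dual (Ker φ) q) (q : Q) : TangentSpace 𝓘(ℝ, EQ) q :=
  mfderiv (dualModel EQ (KerModel F)) 𝓘(ℝ, EQ)
    (fun v : DualTot (KerModel F) (Ker φ) => v.1) ⟨q, α q⟩ (h.vf A ⟨q, α q⟩)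

end HamSection

end Hamiltonian

end HJ

end

/-! The statement is a pointwise one in disguise: `μ ∘ β` carries integral curves of `R_h^{μ∘β}` to
integral curves of `R_h` exactly when `T(μ ∘ β)` maps `R_h^{μ∘β}(q)` to `R_h(μ(β(q)))` for every
`q`. One direction is the chain rule. The other needs an integral curve through each `q`, hence the
smoothness of `R_h^{μ∘β} = ρ(ζ)`, where `ζ = ζ_h^{μ∘β}`. Relatedness at a single `q` is then shown
to be the Hamilton–Jacobi equation at `q` (`related_iff`).

To compare two tangent vectors of `V*` at `μ(β(q))` it is enough to apply differentials of basic
functions `f ∘ τ` and of linear functions `ŝ`, since these span the covectors (`exists_cot_eq`). On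
basic functions the two vectors always agree, because `R_h^{μ∘β}` is by definition the projection of
`R_h`. On `ŝ` the first vector gives `ρ(ζ)(β(s))`. The second gives the bracket `{σ̂, F_h}` at
`h(μ(β(q)))`, where `σ = i_V s`.

That bracket is computed along the section `β' = h ∘ μ ∘ β = β - (F_h ∘ β) φ` (`poisson_lin`). It
equals `d^E β'(σ, ζ) + ρ(ζ)(β'(σ)) - ρ(σ)(F_h ∘ β')`. Here `F_h ∘ β' = 0`, and `β'(σ) = β(σ)`
because `φ(σ) = 0`. Moreover `d^E β' = d^E β - (F_h ∘ β) d^E φ - d^E(F_h ∘ β) ∧ φ`. With `d^E φ =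
0`, `φ(σ) = 0` and `φ(ζ) = 1` (`sec_zeta`), only `d^E β(σ, ζ) - ρ(σ)(F_h ∘ β)` survives. So the two
values on `ŝ` differ by the left side of the Hamilton–Jacobi equation evaluated at `s`
(`dif_lin_vf`). -/

namespace HJ

/-! ### Smoothness criteria for maps into `E*` and sections of `E` -/

section SmoothnessTests

variable {EQ : Type*} [NormedAddCommGroup EQ] [NormedSpace ℝ EQ] [FiniteDimensional ℝ EQ]
  {Q : Type*} [TopologicalSpace Q] [ChartedSpace EQ Q] [IsManifold 𝓘(ℝ, EQ) ∞ Q] [T2Space Q]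
  {F : Type*} [NormedAddCommGroup F] [NormedSpace ℝ F] [FiniteDimensional ℝ F]
  {E : Q → Type*} [TopologicalSpace (TotalSpace F E)] [∀ q, TopologicalSpace (E q)]
  [∀ q, AddCommGroup (E q)] [∀ q, Module ℝ (E q)] [FiberBundle F E] [VectorBundle ℝ F E]
  [ContMDiffVectorBundle ∞ F E 𝓘(ℝ, EQ)]

/-- A vector with constant coordinates extends to a global section near a given point. -/
theorem exists_sec_eventuallyEq (q : Q) (v : F) : ∃ σ : Sec EQ F E,
    ∀ᶠ x in 𝓝 q, σ x = (trivializationAt F E q).symmL ℝ x v := by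
  set t := trivializationAt F E q with ht
  have hq : q ∈ t.baseSet := mem_baseSet_trivializationAt F E q
  obtain ⟨ψ, -, hψ⟩ := (SmoothBumpFunction.nhds_basis_tsupport (I := 𝓘(ℝ, EQ)) q).mem_iff.1
    (t.open_baseSet.mem_nhds hq)
  have hs : ContMDiffOn 𝓘(ℝ, EQ) (𝓘(ℝ, EQ).prod 𝓘(ℝ, F)) ∞
      (fun x => TotalSpace.mk' F x (t.symmL ℝ x v)) t.baseSet := by
    rw [t.contMDiffOn_section_baseSet_iff]
    exact (contMDiffOn_const (c := v)).congr fun x hx => by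
      rw [t.symmL_apply hx, t.apply_mk_symm hx]
  refine ⟨⟨(ψ : Q → ℝ) • fun x => t.symmL ℝ x v,
    ContMDiffOn.smul_section_of_tsupport ψ.contMDiff.contMDiffOn t.open_baseSet hψ hs⟩, ?_⟩
  -- The bump function is identically `1` near `q`, so the cut-off section keeps constant
  -- coordinates on a whole neighbourhood and not only at `q`.
  filter_upwards [ψ.eventuallyEq_one] with x hx
  change ψ x • t.symmL ℝ x v = _
  rw [hx, Pi.one_apply, one_smul]

variable {EM HM M : Type*} [NormedAddCommGroup EM] [NormedSpace ℝ EM] [TopologicalSpace HM]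
  {I : ModelWithCorners ℝ EM HM} [TopologicalSpace M] [ChartedSpace HM M]

/-- A map into `E*` is smooth if its base map and its pairings with sections of `E` are. -/
theorem contMDiff_dualTot_of_pair {f : M → DualTot F E}
    (hb : ContMDiff I 𝓘(ℝ, EQ) ∞ fun x => (f x).1)
    (hf : ∀ σ : Sec EQ F E, ContMDiff I 𝓘(ℝ, ℝ) ∞ fun x => lin σ (f x)) :
    ContMDiff I (dualModel EQ F) ∞ f := by
  intro x₀
  rw [contMDiffAt_totalSpace]
  refine ⟨hb x₀, ?_⟩
  set t := trivializationAt F E (f x₀).1 with ht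
  let b := finBasis ℝ F
  -- The global sections `S i` form a local frame near the base point of `f x₀`, so near `x₀` the
  -- coordinates of `f x` in the dual basis are its pairings with the `S i`.
  choose S hS using fun i => exists_sec_eventuallyEq (EQ := EQ) (E := E) (f x₀).1 (b i)
  have h1 : ContMDiffAt I 𝓘(ℝ, F →L[ℝ] ℝ) ∞ (fun x => ∑ i, lin (S i) (f x) •
      LinearMap.toContinuousLinearMap (b.coord i)) x₀ :=
    contMDiffAt_finsetSum fun i _ => (hf (S i) x₀).smul contMDiffAt_const
  refine h1.congr_of_eventuallyEq ?_
  have hev := fun i => (hb x₀).continuousAt.eventually (hS i)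
  filter_upwards [Filter.eventually_all.2 hev] with x hx
  rw [hom_trivializationAt_apply]
  refine ContinuousLinearMap.coe_injective (b.ext fun j => ?_)
  simp [ContinuousLinearMap.inCoordinates, lin, hx, Finsupp.single_apply, ← ht]

/-- A section of `E` is smooth if its pairings with sections of `E*` are. -/
theorem contMDiff_sec_of_pair {s : ∀ q, E q}
    (hs : ∀ η : Sec EQ (F →L[ℝ] ℝ) (Dual E), ContMDiff 𝓘(ℝ, EQ) 𝓘(ℝ, ℝ) ∞ fun q => η q (s q)) :
    ContMDiff 𝓘(ℝ, EQ) (𝓘(ℝ, EQ).prod 𝓘(ℝ, F)) ∞ (fun q => TotalSpace.mk' F q (s q)) := by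
  intro q
  rw [contMDiffAt_section]
  set t := trivializationAt F E q with ht
  have hq : q ∈ t.baseSet := mem_baseSet_trivializationAt F E q
  let b := finBasis ℝ F
  -- Sections of `E*` which form the dual frame near `q`: pairing with `S i` reads off the `i`-th
  -- coordinate of `s`.
  choose S hS using fun i => exists_sec_eventuallyEq (EQ := EQ) (E := Dual E) q
    (LinearMap.toContinuousLinearMap (b.coord i))
  have h1 : ContMDiffAt 𝓘(ℝ, EQ) 𝓘(ℝ, F) ∞ (fun x => ∑ i, (S i x (s x)) • b i) q :=
    contMDiffAt_finsetSum fun i _ => (hs (S i) q).smul contMDiffAt_const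
  refine h1.congr_of_eventuallyEq ?_
  filter_upwards [Filter.eventually_all.2 hS, t.open_baseSet.mem_nhds hq] with x hx hxt
  rw [← b.sum_repr (t ⟨x, s x⟩).2]
  refine Finset.sum_congr rfl fun i _ => ?_
  rw [hx i]
  congr 1
  -- The chart of `E*` is induced by the chart `t` of `E`. Evaluating this identity at the
  -- coordinates of `s x` shows that the dual frame pairs with `s x` to the coordinate itself.
  have h2 := (trivializationAt (F →L[ℝ] ℝ) (Dual E) q).apply_mk_symm (b := x)
    (by rw [hom_trivializationAt_baseSet]; exact ⟨hxt, mem_univ _⟩)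
    (LinearMap.toContinuousLinearMap (b.coord i))
  rw [Trivialization.symmL_apply _ (by rw [hom_trivializationAt_baseSet]; exact ⟨hxt, mem_univ _⟩)]
  rw [hom_trivializationAt_apply] at h2
  have h3 := congrArg (fun p : Q × (F →L[ℝ] ℝ) => p.2 (t ⟨x, s x⟩).2) h2
  simp [ContinuousLinearMap.inCoordinates, ← ht, t.symmL_apply hxt, t.symm_apply_apply_mk hxt]
    at h3
  exact h3.symm

/-- The derivative in `t` at `0` of a smooth function on `Q × ℝ` is smooth. -/
theorem contMDiff_deriv_param {G : Q → ℝ → ℝ}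
    (hG : ContMDiff (𝓘(ℝ, EQ).prod 𝓘(ℝ, ℝ)) 𝓘(ℝ, ℝ) ∞ (Function.uncurry G)) :
    ContMDiff 𝓘(ℝ, EQ) 𝓘(ℝ, ℝ) ∞ fun q => deriv (G q) 0 := by
  intro q
  have h := ContMDiffAt.mfderiv (m := ∞) (n := ∞) (x₀ := q) G (fun _ => (0 : ℝ)) (hG _)
    contMDiffAt_const (by simp)
  -- Source and target are the vector space `ℝ`, so the tangent coordinate changes are trivial and
  -- leave the ordinary derivative.
  have h1 : inTangentCoordinates 𝓘(ℝ, ℝ) 𝓘(ℝ, ℝ) (fun _ : Q => (0 : ℝ)) (fun x => G x 0)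
      (fun x => mfderiv 𝓘(ℝ, ℝ) 𝓘(ℝ, ℝ) (G x) 0) q = fun x => fderiv ℝ (G x) 0 := by
    ext1 x
    simp [inTangentCoordinates, ContinuousLinearMap.inCoordinates, mfderiv_eq_fderiv]
    rfl
  rw [h1] at h
  have h2 := h.clm_apply (contMDiffAt_const (c := (1 : ℝ)))
  refine h2.congr_of_eventuallyEq (Filter.Eventually.of_forall fun x => ?_)
  exact fderiv_apply_one_eq_deriv.symm

end SmoothnessTests

end HJ

namespace HJ

/-- The derivative of an integral curve is recorded as the linear map `t ↦ t • x`; this passes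
between such maps and the velocity vectors themselves. -/
theorem comp_smulRight_one_eq_iff {X Y : Type*} [NormedAddCommGroup X] [NormedSpace ℝ X]
    [NormedAddCommGroup Y] [NormedSpace ℝ Y] (L : X →L[ℝ] Y) (x : X) (y : Y) :
    L.comp ((1 : ℝ →L[ℝ] ℝ).smulRight x) = (1 : ℝ →L[ℝ] ℝ).smulRight y ↔ L x = y :=
  ⟨fun h => by simpa using congrArg (fun l : ℝ →L[ℝ] Y => l 1) h, fun h => by ext; simp [h]⟩

section HamiltonJacobi

variable {EQ : Type*} [NormedAddCommGroup EQ] [NormedSpace ℝ EQ] [FiniteDimensional ℝ EQ]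
  {Q : Type*} [TopologicalSpace Q] [ChartedSpace EQ Q] [IsManifold 𝓘(ℝ, EQ) ∞ Q] [T2Space Q]
  {F : Type*} [NormedAddCommGroup F] [NormedSpace ℝ F] [FiniteDimensional ℝ F]
  {E : Q → Type*} [TopologicalSpace (TotalSpace F E)] [∀ q, TopologicalSpace (E q)]
  [∀ q, AddCommGroup (E q)] [∀ q, Module ℝ (E q)] [FiberBundle F E] [VectorBundle ℝ F E]
  [ContMDiffVectorBundle ∞ F E 𝓘(ℝ, EQ)]

/-! ### Differentials and Poisson brackets along a section of `E*` -/

namespace SkewAlgebroid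

variable (A : SkewAlgebroid EQ Q F E)

/-- The derivation rule `d^E(β - g φ) = d^E β - g d^E φ - d^E g ∧ φ`, which follows from the product
rule for `g φ(τ)`. It is used with `g = F_h ∘ β`. -/
theorem cartan_of_eq_sub_smul {β β' φ : Sec EQ (F →L[ℝ] ℝ) (Dual E)} {g : Q → ℝ}
    (hβ : ∀ q, β' q = β q - g q • φ q) {q : Q} (hg : MDifferentiableAt 𝓘(ℝ, EQ) 𝓘(ℝ, ℝ) g q)
    (σ γ : Sec EQ F E) : A.cartan β' q σ γ = A.cartan β q σ γ - g q * A.cartan φ q σ γ -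
      (A.dFun g q (σ q) * φ q (γ q) - A.dFun g q (γ q) * φ q (σ q)) := by
  have h1 : ∀ τ : Sec EQ F E, dif 𝓘(ℝ, EQ) (pair β' τ) q = dif 𝓘(ℝ, EQ) (pair β τ) q -
      (g q • dif 𝓘(ℝ, EQ) (pair φ τ) q + pair φ τ q • dif 𝓘(ℝ, EQ) g q) := fun τ => by
    have h2 : pair β τ = fun x => pair β' τ x + g x * pair φ τ x := by
      ext x
      simp [pair, hβ]
    have h3 : MDifferentiableAt 𝓘(ℝ, EQ) 𝓘(ℝ, ℝ) (fun x => g x * pair φ τ x) q :=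
      hg.mul (mdiff_pair φ τ q)
    rw [h2, dif_add (mdiff_pair β' τ q) h3, dif_mul hg (mdiff_pair φ τ q), add_sub_cancel_right]
  simp only [cartan, dFun, ContinuousLinearMap.comp_apply, h1]
  simp only [pair, hβ, _root_.sub_apply, _root_.add_apply, _root_.smul_apply, smul_eq_mul]
  ring

/-- The projection to `Q` of the hamiltonian vector field of `G` is `ρ((dG)~)`. -/
theorem mfderiv_proj_hamVF (G : DualTot F E → ℝ) (α : DualTot F E) :
    mfderiv (dualModel EQ F) 𝓘(ℝ, EQ) (fun α : DualTot F E => α.1) α (A.hamVF G α) =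
      A.anchor α.1 (tilde α (dif (dualModel EQ F) G α)) := by
  -- Tangent vectors are compared through covectors, each of which is some `df`. The basic part of
  -- `dG` contributes to neither side.
  refine (bidual _).injective (LinearMap.ext fun θ => ?_)
  obtain ⟨f, rfl⟩ := exists_dif_eq α.1 θ
  obtain ⟨σ, g, hG⟩ := exists_cot_eq α (dif (dualModel EQ F) G α)
  have h1 := A.dif_hamVF (fun α : DualTot F E => f α.1) G α
  have hP := A.isBivectorAt_bivector α
  rw [dif_base, poisson, hG, map_add, hP.base_lin, hP.base_base, add_zero] at h1
  rw [hG, map_add, tilde_lin, tilde_base, add_zero, (hasMFDerivAt_proj α).mfderiv]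
  exact h1

/-- The bracket `{σ̂, G}` along a section `β` of `E*`. -/
theorem poisson_lin (β : Sec EQ (F →L[ℝ] ℝ) (Dual E)) (σ : Sec EQ F E) {G : DualTot F E → ℝ}
    (q : Q) (hG : MDifferentiableAt (dualModel EQ F) 𝓘(ℝ, ℝ) G ⟨q, β q⟩) :
    A.poisson (lin σ) G ⟨q, β q⟩ =
      A.dForm β q (σ q) (tilde (⟨q, β q⟩ : DualTot F E) (dif (dualModel EQ F) G ⟨q, β q⟩)) +
      A.dFun (pair β σ) q (tilde (⟨q, β q⟩ : DualTot F E) (dif (dualModel EQ F) G ⟨q, β q⟩)) -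
      A.dFun (fun x => G ⟨x, β x⟩) q (σ q) := by
  set α : DualTot F E := ⟨q, β q⟩ with hα
  let s : Q → DualTot F E := fun x => ⟨x, β x⟩
  have hs : MDifferentiableAt 𝓘(ℝ, EQ) (dualModel EQ F) s q :=
    β.contMDiff.mdifferentiableAt (by simp)
  have hS : ∀ H : DualTot F E → ℝ, MDifferentiableAt (dualModel EQ F) 𝓘(ℝ, ℝ) H α →
      dif 𝓘(ℝ, EQ) (fun x => H (s x)) q =
      (dif (dualModel EQ F) H α).comp (mfderiv 𝓘(ℝ, EQ) (dualModel EQ F) s q) := fun H hH =>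
    mfderiv_comp q (g := H) (f := s) hH hs
  -- Every term depends on `G` only through `dG` at `α`, so `G` can be replaced by `γ̂ + f ∘ τ`, for
  -- which the defining relations of the bivector give the bracket.
  obtain ⟨γ, f, hγ⟩ := exists_cot_eq α (dif (dualModel EQ F) G α)
  have hP := A.isBivectorAt_bivector α
  have hG' := hS G hG
  have hf : MDifferentiableAt (dualModel EQ F) 𝓘(ℝ, ℝ) (fun α : DualTot F E => f α.1) α :=
    (f.contMDiff.comp (contMDiff_proj (Dual E))).mdifferentiableAt (by simp)
  rw [hγ, ContinuousLinearMap.add_comp, ← hS _ ((contMDiff_lin γ).mdifferentiableAt (by simp)),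
    ← hS _ hf] at hG'
  have ht : tilde α (dif (dualModel EQ F) G α) = γ q := by
    rw [hγ, map_add, tilde_lin, tilde_base, add_zero]
  rw [ht, dForm_apply, cartan, poisson, hγ, map_add, hP.lin_lin, hP.skew (dif _ (lin σ) α),
    hP.base_lin]
  have h1 : A.dFun (fun x => G ⟨x, β x⟩) q (σ q) =
      A.dFun (pair β γ) q (σ q) + A.dFun f q (σ q) :=
    congrArg (fun l : TangentSpace 𝓘(ℝ, EQ) q →L[ℝ] ℝ => l (A.anchor q (σ q))) hG'
  rw [h1]
  change -pair β (A.bracket σ γ) q + -A.dFun f q (σ q) = _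
  ring

end SkewAlgebroid

/-! ### The function `F_h` and the section `ζ_h` -/

variable (φ : NonvanishingForm EQ F E)

/-- For a section `s` of `V`, the pullback `ŝ ∘ μ` is the linear function of `i_V s`, hence smooth.
-/
theorem contMDiff_muTot :
    ContMDiff (dualModel EQ F) (dualModel EQ (KerModel F)) ∞ (muTot φ) :=
  contMDiff_dualTot_of_pair (contMDiff_proj (Dual E)) fun s => contMDiff_lin (inclSec φ s)

variable {φ}

namespace HamSection

variable (h : HamSection φ)

theorem contMDiff_tot : ContMDiff (dualModel EQ (KerModel F)) (dualModel EQ F) ∞ h.tot :=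
  h.contMDiff'

theorem fn_eq_of_sub_eq {α : DualTot F E} {r : ℝ}
    (hr : α.2 - h.toFun α.1 (muFib φ α.1 α.2) = r • φ.sec α.1) : h.fn α = r :=
  (h.existsUnique_fn α).unique (h.fn_spec α) hr

/-- Pairing `α - h(μ(α)) = F_h(α) φ` with a section `σ` for which `φ(σ)` is nonzero at the base
point expresses `F_h` locally as a quotient of smooth functions. -/
theorem contMDiff_fn : ContMDiff (dualModel EQ F) 𝓘(ℝ, ℝ) ∞ h.fn := by
  intro α₀
  obtain ⟨u, hu⟩ : ∃ u, φ.sec α₀.1 u ≠ 0 := by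
    by_contra! hc
    exact φ.ne_zero α₀.1 (ContinuousLinearMap.ext hc)
  obtain ⟨σ, rfl⟩ := exists_sec (EQ := EQ) (F := F) α₀.1 u
  have hp : ContMDiff (dualModel EQ F) 𝓘(ℝ, ℝ) ∞
      (fun α : DualTot F E => SkewAlgebroid.pair φ.sec σ α.1) :=
    (SkewAlgebroid.contMDiff_pair φ.sec σ).comp (contMDiff_proj (Dual E))
  have h1 : ContMDiffAt (dualModel EQ F) 𝓘(ℝ, ℝ) ∞
      (fun α : DualTot F E => (SkewAlgebroid.pair φ.sec σ α.1)⁻¹ *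
        (lin σ α - lin σ (h.tot (muTot φ α)))) α₀ :=
    ((hp α₀).inv₀ hu).mul ((contMDiff_lin σ).sub
      ((contMDiff_lin σ).comp (h.contMDiff_tot.comp (contMDiff_muTot φ))) α₀)
  refine h1.congr_of_eventuallyEq ?_
  filter_upwards [hp.continuous.continuousAt.eventually_ne hu] with α hα
  have h2 := congrArg (fun l : Dual E α.1 => l (σ α.1)) (h.fn_spec α)
  have h3 : lin σ α - lin σ (h.tot (muTot φ α)) =
      h.fn α * SkewAlgebroid.pair φ.sec σ α.1 := h2
  rw [h3, mul_comm, mul_inv_cancel_right₀ hα]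

theorem fn_tot (v : DualTot (KerModel F) (Ker φ)) : h.fn (h.tot v) = 0 :=
  h.fn_eq_of_sub_eq (by
    change h.toFun v.1 v.2 - h.toFun v.1 (muFib φ v.1 (h.toFun v.1 v.2)) = _
    rw [h.mu_toFun, sub_self]
    exact (zero_smul ℝ _).symm)

/-- `φ` vanishes on `V`, so adding `r φ` does not change `μ`, and the whole increment is absorbed by
`F_h`. -/
theorem fn_add_smul (q : Q) (a : Dual E q) (r : ℝ) :
    h.fn ⟨q, a + r • φ.sec q⟩ = h.fn ⟨q, a⟩ + r :=
  h.fn_eq_of_sub_eq (by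
    have h1 : muFib φ q (a + r • φ.sec q) = muFib φ q a := by
      ext v
      simp [muFib, apply_incl]
    have h2 := h.fn_spec ⟨q, a⟩
    change a + r • φ.sec q - h.toFun q (muFib φ q (a + r • φ.sec q)) = _
    rw [h1, add_sub_right_comm, h2, add_smul])

theorem apply_zeta (α : ∀ q, Dual (Ker φ) q) (q : Q) (ξ : Dual E q) :
    ξ (h.zeta α q) = deriv (fun t : ℝ => h.fn ⟨q, h.toFun q (α q) + t • ξ⟩) 0 :=
  have hd : MDifferentiableAt (dualModel EQ F) 𝓘(ℝ, ℝ) h.fn ⟨q, h.toFun q (α q)⟩ :=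
    h.contMDiff_fn.mdifferentiableAt (by simp)
  (apply_tilde (⟨q, h.toFun q (α q)⟩ : DualTot F E)
    (dif (dualModel EQ F) h.fn ⟨q, h.toFun q (α q)⟩) ξ).trans
    (dif_vlift (⟨q, h.toFun q (α q)⟩ : DualTot F E) hd ξ)

/-- `φ(ζ)` is the derivative of `F_h` in the vertical direction `φ`, along which `F_h` is affine of
slope one. This normalization makes the term `d^V(F_h ∘ β)` appear with coefficient one. -/
theorem sec_zeta (α : ∀ q, Dual (Ker φ) q) (q : Q) : φ.sec q (h.zeta α q) = 1 := by
  rw [apply_zeta]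
  simp only [fn_add_smul]
  simp

/-- The section `h ∘ μ ∘ β` of `E*`. -/
noncomputable def proj (β : Sec EQ (F →L[ℝ] ℝ) (Dual E)) : Sec EQ (F →L[ℝ] ℝ) (Dual E) :=
  ⟨fun q => h.toFun q (muFib φ q (β q)),
    h.contMDiff_tot.comp ((contMDiff_muTot φ).comp β.contMDiff)⟩

theorem proj_apply (β : Sec EQ (F →L[ℝ] ℝ) (Dual E)) (q : Q) :
    h.proj β q = β q - h.fn ⟨q, β q⟩ • φ.sec q := by
  rw [← h.fn_spec ⟨q, β q⟩, sub_sub_cancel]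
  rfl

/-- Each pairing `η(ζ)` is the derivative at `t = 0` of `F_h(h(μ(β(q))) + t η(q))`, a smooth
function on `Q × ℝ`. -/
theorem contMDiff_zeta (β : Sec EQ (F →L[ℝ] ℝ) (Dual E)) :
    ContMDiff 𝓘(ℝ, EQ) (𝓘(ℝ, EQ).prod 𝓘(ℝ, F)) ∞
      (fun q => TotalSpace.mk' F q (h.zeta (fun x => muFib φ x (β x)) q)) := by
  refine contMDiff_sec_of_pair fun η => ?_
  have h1 : ContMDiff (𝓘(ℝ, EQ).prod 𝓘(ℝ, ℝ)) (dualModel EQ F) ∞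
      (fun p : Q × ℝ => (⟨p.1, h.proj β p.1 + p.2 • η p.1⟩ : DualTot F E)) :=
    contMDiff_dualTot_of_pair contMDiff_fst fun σ =>
      ((SkewAlgebroid.contMDiff_pair (h.proj β) σ).comp contMDiff_fst).add
        (contMDiff_snd.mul ((SkewAlgebroid.contMDiff_pair η σ).comp contMDiff_fst))
  have h2 := contMDiff_deriv_param
    (G := fun q t => h.fn ⟨q, h.proj β q + t • η q⟩) (h.contMDiff_fn.comp h1)
  exact h2.congr fun q => h.apply_zeta _ q (η q)

/-! ### The vector fields `R_h` and `R_h^{μ∘β}` -/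

variable (A : SkewAlgebroid EQ Q F E)

/-- Since `τ_{V*} ∘ μ = τ_{E*}`, the projection of `R_h` to `Q` is that of `H_{F_h}`. -/
theorem mfderiv_proj_vf (v : DualTot (KerModel F) (Ker φ)) :
    mfderiv (dualModel EQ (KerModel F)) 𝓘(ℝ, EQ)
      (fun v : DualTot (KerModel F) (Ker φ) => v.1) v (h.vf A v) =
      A.anchor v.1 (tilde (h.tot v) (dif (dualModel EQ F) h.fn (h.tot v))) := by
  refine Eq.trans ?_ (A.mfderiv_proj_hamVF h.fn (h.tot v))
  rw [(hasMFDerivAt_proj v).mfderiv]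
  have h1 := mfderiv_comp_of_eq (x := h.tot v) (f := muTot φ)
    (g := fun v : DualTot (KerModel F) (Ker φ) => v.1)
    (hasMFDerivAt_proj v).mdifferentiableAt
    ((contMDiff_muTot φ).mdifferentiableAt (by simp)) (h.muTot_tot v)
  rw [h.muTot_tot, (hasMFDerivAt_proj v).mfderiv] at h1
  exact (congrArg (fun l => l (A.hamVF h.fn (h.tot v))) h1).symm

theorem baseVF_eq (β : Sec EQ (F →L[ℝ] ℝ) (Dual E)) (q : Q) :
    h.baseVF A (fun x => muFib φ x (β x)) q =
      A.anchor q (h.zeta (fun x => muFib φ x (β x)) q) :=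
  h.mfderiv_proj_vf A ⟨q, muFib φ q (β q)⟩

theorem contMDiff_baseVF (β : Sec EQ (F →L[ℝ] ℝ) (Dual E)) :
    ContMDiff 𝓘(ℝ, EQ) 𝓘(ℝ, EQ).tangent ∞ (fun q =>
      (⟨q, h.baseVF A (fun x => muFib φ x (β x)) q⟩ : TangentBundle 𝓘(ℝ, EQ) Q)) := by
  simp only [baseVF_eq]
  exact A.contMDiff_anchor.comp (h.contMDiff_zeta β)

/-- The derivative of the linear function of a section `s` of `V` along `R_h`. -/
theorem dif_lin_vf (hφ : A.IsCocycle φ.sec) (β : Sec EQ (F →L[ℝ] ℝ) (Dual E)) (q : Q)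
    (s : Sec EQ (KerModel F) (Ker φ)) :
    dif (dualModel EQ (KerModel F)) (lin s) ⟨q, muFib φ q (β q)⟩
        (h.vf A ⟨q, muFib φ q (β q)⟩) =
      A.dFun (SkewAlgebroid.pair β (inclSec φ s)) q (h.zeta (fun x => muFib φ x (β x)) q) -
      (muFib φ q (A.dForm β q (h.zeta (fun x => muFib φ x (β x)) q)) +
        (A.restrict φ hφ).dFun (fun x => h.fn ⟨x, β x⟩) q) (s q) := by
  set v : DualTot (KerModel F) (Ker φ) := ⟨q, muFib φ q (β q)⟩ with hv
  set ζ := h.zeta (fun x => muFib φ x (β x)) q with hζ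
  set σ := inclSec φ s with hσ
  have hσ0 : ∀ x, φ.sec x (σ x) = 0 := fun x => apply_incl φ x (s x)
  have h1 := mfderiv_comp_of_eq (x := h.tot v) (f := muTot φ) (g := lin s)
    (I := dualModel EQ F) (I' := dualModel EQ (KerModel F)) (I'' := 𝓘(ℝ, ℝ))
    ((contMDiff_lin s).mdifferentiableAt (by simp))
    ((contMDiff_muTot φ).mdifferentiableAt (by simp)) (h.muTot_tot v)
  rw [h.muTot_tot] at h1
  have h2 : dif (dualModel EQ (KerModel F)) (lin s) v (h.vf A v) =
      A.poisson (lin σ) h.fn (h.tot v) := by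
    rw [← A.dif_hamVF]
    exact (congrArg (fun l => l (A.hamVF h.fn (h.tot v))) h1).symm
  -- `R_h` at `μ(β(q))` is computed at the point `h(μ(β(q)))`, so the bracket is taken along `h ∘ μ
  -- ∘ β` and not along `β`.
  have h3 := A.poisson_lin (h.proj β) σ (G := h.fn) q (h.contMDiff_fn.mdifferentiableAt (by simp))
  have h4 : (fun x => h.fn ⟨x, h.proj β x⟩) = fun _ => 0 :=
    funext fun x => h.fn_tot ⟨x, muFib φ x (β x)⟩
  have h5 : SkewAlgebroid.pair (h.proj β) σ = SkewAlgebroid.pair β σ := funext fun x => by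
    simp [SkewAlgebroid.pair, proj_apply, hσ0]
  have h6 : A.dFun (fun _ : Q => (0 : ℝ)) q = 0 := by
    have : dif 𝓘(ℝ, EQ) (fun _ : Q => (0 : ℝ)) q = 0 := mfderiv_const
    rw [SkewAlgebroid.dFun, this, ContinuousLinearMap.zero_comp]
  rw [h4, h5, h6] at h3
  obtain ⟨γ, hγ⟩ := exists_sec (EQ := EQ) (F := F) q ζ
  have hg : MDifferentiableAt 𝓘(ℝ, EQ) 𝓘(ℝ, ℝ) (fun x => h.fn ⟨x, β x⟩) q :=
    (h.contMDiff_fn.comp β.contMDiff).mdifferentiableAt (by simp)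
  -- The cocycle condition removes the `d^E φ` term. In the wedge term `φ(σ) = 0` and `φ(ζ) = 1`
  -- leave only `ρ(σ)(F_h ∘ β)`.
  have h7 := A.cartan_of_eq_sub_smul (h.proj_apply β) hg σ γ
  rw [← A.dForm_apply φ.sec, hφ q, hσ0, ← A.dForm_apply, ← A.dForm_apply, hγ, h.sec_zeta,
    A.dForm_skew β] at h7
  have h8 : A.poisson (lin σ) h.fn (h.tot v) = A.dForm (h.proj β) q (σ q) ζ +
      A.dFun (SkewAlgebroid.pair β σ) q ζ - 0 := h3
  rw [h2, h8, h7]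
  change _ = A.dFun (SkewAlgebroid.pair β σ) q ζ -
    (A.dForm β q ζ (σ q) + A.dFun (fun x => h.fn ⟨x, β x⟩) q (σ q))
  simp
  ring

/-- `μ ∘ β` relates `R_h^{μ ∘ β}` and `R_h` at `q` if and only if `β` satisfies the
Hamilton–Jacobi equation at `q`. -/
theorem related_iff (hφ : A.IsCocycle φ.sec) (β : Sec EQ (F →L[ℝ] ℝ) (Dual E)) (q : Q) :
    (mfderiv 𝓘(ℝ, EQ) (dualModel EQ (KerModel F)) (fun x => muTot φ ⟨x, β x⟩) q
      (h.baseVF A (fun x => muFib φ x (β x)) q) :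
        TangentSpace (dualModel EQ (KerModel F)) (muTot φ ⟨q, β q⟩)) =
      h.vf A (muTot φ ⟨q, β q⟩) ↔
    muFib φ q (A.dForm β q (h.zeta (fun x => muFib φ x (β x)) q)) +
      (A.restrict φ hφ).dFun (fun x => h.fn ⟨x, β x⟩) q = 0 := by
  set v : DualTot (KerModel F) (Ker φ) := muTot φ ⟨q, β q⟩ with hv
  set ζ := h.zeta (fun x => muFib φ x (β x)) q with hζ
  have hm : MDifferentiableAt 𝓘(ℝ, EQ) (dualModel EQ (KerModel F))
      (fun x => muTot φ ⟨x, β x⟩) q :=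
    ((contMDiff_muTot φ).comp β.contMDiff).mdifferentiableAt (by simp)
  set X : TangentSpace (dualModel EQ (KerModel F)) v :=
    mfderiv 𝓘(ℝ, EQ) (dualModel EQ (KerModel F)) (fun x => muTot φ ⟨x, β x⟩) q
      (h.baseVF A (fun x => muFib φ x (β x)) q) with hX
  have hlin : ∀ s : Sec EQ (KerModel F) (Ker φ),
      dif (dualModel EQ (KerModel F)) (lin s) v X =
        A.dFun (SkewAlgebroid.pair β (inclSec φ s)) q ζ := fun s => by
    have h1 := mfderiv_comp (x := q) (f := fun x => muTot φ ⟨x, β x⟩) (g := lin s)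
      ((contMDiff_lin s).mdifferentiableAt (by simp)) hm
    have h2 := congrArg (fun l : TangentSpace 𝓘(ℝ, EQ) q →L[ℝ] ℝ => l (A.anchor q ζ)) h1
    rw [hX, baseVF_eq]
    exact h2.symm
  -- `τ ∘ μ ∘ β` is the identity of `Q`, and `R_h^{μ∘β}` is the projection of `R_h`, so basic
  -- functions never distinguish the two vectors.
  have hbase : ∀ f : SmoothFun EQ Q, dif (dualModel EQ (KerModel F))
      (fun α : DualTot (KerModel F) (Ker φ) => f α.1) v X =
      dif (dualModel EQ (KerModel F))
      (fun α : DualTot (KerModel F) (Ker φ) => f α.1) v (h.vf A v) := fun f => by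
    have h1 := mfderiv_comp (x := q) (f := fun x => muTot φ ⟨x, β x⟩)
      (g := fun α : DualTot (KerModel F) (Ker φ) => f α.1) (I'' := 𝓘(ℝ, ℝ))
      ((f.contMDiff.comp (contMDiff_proj (Dual (Ker φ)))).mdifferentiableAt (by simp)) hm
    have h2 := congrArg (fun l : TangentSpace 𝓘(ℝ, EQ) q →L[ℝ] ℝ =>
      l (h.baseVF A (fun x => muFib φ x (β x)) q)) h1
    refine Eq.trans h2.symm ?_
    rw [dif_base]
    rw [baseVF, (hasMFDerivAt_proj _).mfderiv]
    rfl
  constructor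
  · intro hXv
    ext w
    obtain ⟨s, rfl⟩ := exists_sec (EQ := EQ) (F := KerModel F) q w
    have h1 := h.dif_lin_vf A hφ β q s
    have h2 := hlin s
    rw [hXv] at h2
    have h3 := h2.symm.trans h1
    rw [eq_comm, sub_eq_self] at h3
    exact h3
  · intro hHJ
    refine (bidual _).injective (LinearMap.ext fun θ => ?_)
    -- Linear and basic differentials span the covectors of `V*`: the equation settles the linear
    -- part, and the basic part agrees without it.
    obtain ⟨s, f, rfl⟩ := exists_cot_eq (F := KerModel F) (E := Ker φ) v θ
    have h1 := h.dif_lin_vf A hφ β q s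
    rw [hHJ] at h1
    have h2 : dif (dualModel EQ (KerModel F)) (lin s) v (h.vf A v) =
      A.dFun (SkewAlgebroid.pair β (inclSec φ s)) q ζ := h1.trans (sub_zero _)
    exact congrArg₂ (· + ·) ((hlin s).trans h2.symm) (hbase f)

end HamSection

end HamiltonJacobi

end HJ

/-! ### From relatedness at each point to integral curves -/

theorem corollary3p2
    {EQ : Type*} [NormedAddCommGroup EQ] [NormedSpace ℝ EQ] [FiniteDimensional ℝ EQ]
    {Q : Type*} [TopologicalSpace Q] [ChartedSpace EQ Q] [IsManifold 𝓘(ℝ, EQ) ∞ Q]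
    [T2Space Q] [SigmaCompactSpace Q]
    {F : Type*} [NormedAddCommGroup F] [NormedSpace ℝ F] [FiniteDimensional ℝ F]
    {E : Q → Type*} [TopologicalSpace (TotalSpace F E)] [∀ q, TopologicalSpace (E q)]
    [∀ q, AddCommGroup (E q)] [∀ q, Module ℝ (E q)] [FiberBundle F E] [VectorBundle ℝ F E]
    [ContMDiffVectorBundle ∞ F E 𝓘(ℝ, EQ)]
    (A : HJ.SkewAlgebroid EQ Q F E) (φ : HJ.NonvanishingForm EQ F E)
    (hφ : A.IsCocycle φ.sec) (h : HJ.HamSection φ)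
    (β : HJ.Sec EQ (F →L[ℝ] ℝ) (HJ.Dual E)) :
    (∀ (c : ℝ → Q) (J : Set ℝ), IsOpen J → J.OrdConnected →
      IsMIntegralCurveOn (I := 𝓘(ℝ, EQ)) c (h.baseVF A fun q => HJ.muFib φ q (β q)) J →
      IsMIntegralCurveOn (I := HJ.dualModel EQ (HJ.KerModel F))
        (fun t => HJ.muTot φ ⟨c t, β (c t)⟩) (h.vf A) J) ↔
    ∀ q : Q, HJ.muFib φ q (A.dForm β q (h.zeta (fun x => HJ.muFib φ x (β x)) q)) +
      (A.restrict φ hφ).dFun (fun x => h.fn ⟨x, β x⟩) q = 0 := by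
  have hm : ∀ q, MDifferentiableAt 𝓘(ℝ, EQ) (HJ.dualModel EQ (HJ.KerModel F))
      (fun x => HJ.muTot φ ⟨x, β x⟩) q := fun q =>
    ((HJ.contMDiff_muTot φ).comp β.contMDiff).mdifferentiableAt (by simp)
  constructor
  · intro hI q
    rw [← h.related_iff A hφ β q]
    -- A local integral curve of `R_h^{μ∘β}` with `c 0 = q` exists because the field is smooth. It
    -- is integral on some ball around `0`, an open interval to which (i) applies.
    obtain ⟨c, hc0, hc⟩ := exists_isMIntegralCurveAt_of_contMDiffAt_boundaryless
      (I := 𝓘(ℝ, EQ)) (t₀ := 0) (x₀ := q)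
      ((h.contMDiff_baseVF A β q).of_le (by norm_cast))
    obtain ⟨ε, hε, hcε⟩ := isMIntegralCurveAt_iff'.1 hc
    have hcomp := (hI c _ Metric.isOpen_ball
      (by rw [Real.ball_eq_Ioo]; exact ordConnected_Ioo) hcε).isMIntegralCurveAt
        (Metric.ball_mem_nhds 0 hε) |>.hasMFDerivAt
    -- The velocity of `μ ∘ β ∘ c` at `0` is `T(μ ∘ β)(R_h^{μ∘β}(q))` by the chain rule and
    -- `R_h(μ(β(q)))` by (i); uniqueness of derivatives identifies the two.
    have h1 := (hm (c 0)).hasMFDerivAt.comp (0 : ℝ) hc.hasMFDerivAt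
    subst hc0
    exact (HJ.comp_smulRight_one_eq_iff (X := EQ) (Y := EQ × (HJ.KerModel F →L[ℝ] ℝ)) _ _ _).1
      (hasMFDerivAt_unique h1 hcomp)
  · intro hHJ c J _ _ hc t ht
    have h1 := (hm (c t)).hasMFDerivAt.comp_hasMFDerivWithinAt t (hc t ht)
    exact h1.congr_mfderiv <|
      (HJ.comp_smulRight_one_eq_iff (X := EQ) (Y := EQ × (HJ.KerModel F →L[ℝ] ℝ)) _ _ _).2
        ((h.related_iff A hφ β (c t)).2 (hHJ (c t)))
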